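/- Conventions. An affine $3$-manifold is a Hausdorff, second countable manifold without boundary with an atlas of charts to $\mathbb R^3$ whose changes of charts are locally affine. Let $M$ be a simply connected affine $3$-manifold and let $\mathrm{dev}: M\to\mathbb R^3$ be a developing map, i.e. an affine immersion. Let $\mathbf d$ be the distance on $M$ of the Riemannian metric obtained by pulling back the Euclidean metric by $\mathrm{dev}$ (the infimum of lengths of paths), let $\check M$ be the Cauchy completion of $(M,\mathbf d)$, let $M_\infty=\check M\setminus M$ be the ideal set, and denote the continuous extension of the developing map to $\check M$ again by $\mathrm{dev}$. A $3$-simplex in $\check M$ is a compact set $T\subset\check M$ such that $\mathrm{dev}|_T$ is a topological embedding onto a nondegenerate closed affine $3$-simplex of $\mathbb R^3$ and such that the interior $T^o$ of $T$ lies in $M$; its sides $F_1,\dots,F_4$ correspond to the sides of the affine simplex. $M$ is called $2$-convex if for every $3$-simplex $T\subset \check M$ with sides $F_1,\dots,F_4$ such that $T^o\cup F_2\cup F_3\cup F_4$ does not meet $M_\infty$, $T$ does not meet $M_\infty$. Let $x_1: M\to\mathbb R$ be the first coordinate of $\mathrm{dev}$ and $M_t=x_1^{-1}(t)$ the level sets.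 An embedding is a smooth ($C^\infty$) topological embedding with injective differentials; smoothness on a product with a compact interval $[a,b]$ means smoothness on the product with some open neighbourhood of $[a,b]$ in $\mathbb R$, after extension. Theorem (filling of a drum). Let $M$ be a simply connected $2$-convex affine $3$-manifold, let $\Omega$ be a compact smooth surface with boundary $\delta\Omega$ (a union of disjoint simple closed curves; for instance a compact domain with smooth boundary in $\mathbb R^2$), let $a<b$ be real numbers and let $e\in\{a,b\}$. Let $f:\delta\Omega\times[a,b]\to M$ be a smooth map such that (i) for each $t\in[a,b]$, $f|_{\delta\Omega\times\{t\}}$ is an embedding of $\delta\Omega$ into $M$ with image in $M_t$; (ii) $f$ is transversal to each level set $M_t$; (iii) $f|_{\delta\Omega\times\{e\}}$ extends to an embedding $f':\Omega\times\{e\}\to M$ with image in $M_e$. Then $f$ and $f'$ extend to a common solid-cylinder embedding $\mathcal F:\Omega\times[a,b]\to M$: an embedding with $\mathcal F(\Omega\times\{t\})\subset M_t$ for every $t\in[a,b]$, $\mathcal F=f$ on $\delta\Omega\times[a,b]$ and $\mathcal F=f'$ on $\Omega\times\{e\}$. -/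

import Mathlib

open Set Topology
open scoped Manifold ContDiff ENNReal

noncomputable section

namespace Drum

/-! ## Affine manifolds and developing maps -/

/-- The local transformations of `ℝⁿ` that agree with an affine map near every point of `s`. -/
def IsLocallyAffineOn {n : ℕ} (f : EuclideanSpace ℝ (Fin n) → EuclideanSpace ℝ (Fin n))
    (s : Set (EuclideanSpace ℝ (Fin n))) : Prop :=
  ∀ x ∈ s, ∃ A : EuclideanSpace ℝ (Fin n) →ᵃ[ℝ] EuclideanSpace ℝ (Fin n),
    ∀ᶠ y in 𝓝[s] x, f y = A y

/-- Locally affine maps form a pregroupoid. -/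
def affinePregroupoid (n : ℕ) : Pregroupoid (EuclideanSpace ℝ (Fin n)) where
  property f s := IsLocallyAffineOn f s
  comp := by
    intro f g u v hf hg _ _ _ x hx
    obtain ⟨A, hA⟩ := hf x hx.1
    obtain ⟨B, hB⟩ := hg (f x) hx.2
    have hfx : f x = A x := hA.self_of_nhdsWithin hx.1
    refine ⟨B.comp A, ?_⟩
    have hA' : ∀ᶠ y in 𝓝[u ∩ f ⁻¹' v] x, f y = A y :=
      hA.filter_mono (nhdsWithin_mono _ inter_subset_left)
    have hcont : Filter.Tendsto f (𝓝[u ∩ f ⁻¹' v] x) (𝓝[v] (f x)) := by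
      refine tendsto_nhdsWithin_iff.2 ⟨?_, ?_⟩
      · have hc : Continuous A := A.continuous_of_finiteDimensional
        have : Filter.Tendsto A (𝓝[u ∩ f ⁻¹' v] x) (𝓝 (f x)) := by
          rw [hfx]
          exact hc.continuousAt.tendsto.mono_left nhdsWithin_le_nhds
        exact this.congr' (hA'.mono fun y hy => hy.symm)
      · filter_upwards [self_mem_nhdsWithin] with y hy using hy.2
    filter_upwards [hA', hcont.eventually hB] with y h1 h2
    simp only [Function.comp_apply, AffineMap.comp_apply, ← h1, h2]
  id_mem := fun _ _ => ⟨AffineMap.id ℝ _, Filter.Eventually.of_forall fun _ => rfl⟩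
  locality := by
    intro f u _ h x hx
    obtain ⟨v, hv, hxv, hfv⟩ := h x hx
    obtain ⟨A, hA⟩ := hfv x ⟨hx, hxv⟩
    refine ⟨A, ?_⟩
    rwa [nhdsWithin_inter_of_mem' (nhdsWithin_le_nhds (hv.mem_nhds hxv))] at hA
  congr := by
    intro f g u _ hfg hf x hx
    obtain ⟨A, hA⟩ := hf x hx
    refine ⟨A, ?_⟩
    filter_upwards [hA, self_mem_nhdsWithin] with y h1 h2
    rw [hfg y h2, h1]

/-- The groupoid of local affine isomorphisms of `ℝⁿ`.  An affine `n`-manifold is a charted space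
over `ℝⁿ` with `HasGroupoid M (affineGroupoid n)`: all changes of charts are locally affine. -/
def affineGroupoid (n : ℕ) : StructureGroupoid (EuclideanSpace ℝ (Fin n)) :=
  (affinePregroupoid n).groupoid

theorem IsLocallyAffineOn.contDiffOn {n : ℕ} 
    {f : EuclideanSpace ℝ (Fin n) → EuclideanSpace ℝ (Fin n)} {s : Set (EuclideanSpace ℝ (Fin n))}
    (hf : IsLocallyAffineOn f s) : ContDiffOn ℝ ∞ f s := by
  intro x hx
  obtain ⟨A, hA⟩ := hf x hx
  have : ContDiff ℝ ∞ A := 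
    (⟨A, A.continuous_of_finiteDimensional⟩ : _ →ᴬ[ℝ] _).contDiff
  exact this.contDiffWithinAt.congr_of_eventuallyEq hA (hA.self_of_nhdsWithin hx)

theorem affineGroupoid_le (n : ℕ) : affineGroupoid n ≤ contDiffGroupoid ∞ (𝓡 n) := by
  rw [affineGroupoid, contDiffGroupoid]
  apply groupoid_of_pregroupoid_le
  intro f s h
  simpa [contDiffPregroupoid, affinePregroupoid] using IsLocallyAffineOn.contDiffOn h

/-- An affine manifold is a smooth manifold. -/
theorem isManifold_of_affine {n : ℕ} {M : Type*} [TopologicalSpace M]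
    [ChartedSpace (EuclideanSpace ℝ (Fin n)) M]
    [HasGroupoid M (affineGroupoid n)] : IsManifold (𝓡 n) ∞ M :=
  have := hasGroupoid_of_le (M := M) inferInstance (affineGroupoid_le n)
  IsManifold.mk' _ _ _

section Develop

variable {n : ℕ} {M : Type*} [TopologicalSpace M] [ChartedSpace (EuclideanSpace ℝ (Fin n)) M]

/-- A developing map of a simply connected affine manifold: an affine immersion into `ℝⁿ`, that
is, a map which in every chart of the affine structure is locally an affine isomorphism. -/
def IsDevelopingMap (dev : M → EuclideanSpace ℝ (Fin n)) : Prop :=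
  ∀ e ∈ atlas (EuclideanSpace ℝ (Fin n)) M, ∀ y ∈ e.target,
    ∃ A : EuclideanSpace ℝ (Fin n) ≃ᵃ[ℝ] EuclideanSpace ℝ (Fin n),
      ∀ᶠ z in 𝓝 y, dev (e.symm z) = A z

/-! ## The completion -/

/-- The norm of the Riemannian metric `dev^* (Euclidean metric)` on the tangent spaces of `M`. -/
abbrev devENorm (dev : M → EuclideanSpace ℝ (Fin n)) (x : M) :
    ENorm (TangentSpace (𝓡 n) x) :=
  ⟨fun v => enorm (E := EuclideanSpace ℝ (Fin n))
    (mfderiv (𝓡 n) 𝓘(ℝ, EuclideanSpace ℝ (Fin n)) dev x v)⟩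

theorem devENorm_smul (dev : M → EuclideanSpace ℝ (Fin n)) (x : M) :
    letI := devENorm dev x
    ENormSMulClass ℝ (TangentSpace (𝓡 n) x) := by
  refine @ENormSMulClass.mk _ _ _ (devENorm dev x) _ fun r v => ?_
  change enorm (E := EuclideanSpace ℝ (Fin n))
    (mfderiv (𝓡 n) 𝓘(ℝ, EuclideanSpace ℝ (Fin n)) dev x (r • v)) = _
  rw [map_smul]
  exact enorm_smul (β := EuclideanSpace ℝ (Fin n)) r _

/-- The distance on `M` of the Riemannian metric `dev^* (Euclidean metric)`: the infimum of the
lengths of `C¹` paths. -/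
def devEDist (dev : M → EuclideanSpace ℝ (Fin n)) (x y : M) : ℝ≥0∞ :=
  letI := devENorm dev
  Manifold.riemannianEDist (𝓡 n) x y

/-- A copy of `M`, equipped with the distance `devEDist dev`. -/
@[nolint unusedArguments]
def DevSpace (_dev : M → EuclideanSpace ℝ (Fin n)) : Type _ := M

instance (dev : M → EuclideanSpace ℝ (Fin n)) : PseudoEMetricSpace (DevSpace dev) where
  edist x y := devEDist dev x y
  edist_self x := by
    let := devENorm dev
    have := devENorm_smul dev
    exact Manifold.riemannianEDist_self (I := 𝓡 n) (M := M)
  edist_comm x y := by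
    let := devENorm dev
    have := devENorm_smul dev
    exact Manifold.riemannianEDist_comm (I := 𝓡 n) (M := M)
  edist_triangle x y z := by
    let := devENorm dev
    have := devENorm_smul dev
    exact Manifold.riemannianEDist_triangle (I := 𝓡 n) (M := M)

/-- The completion `M̌` of a simply connected affine manifold `M` with developing map `dev`: the
Cauchy completion of `M` for the distance induced by `dev`. -/
abbrev DevCompletion (dev : M → EuclideanSpace ℝ (Fin n)) : Type _ :=
  UniformSpace.Completion (DevSpace dev)

/-- The image of `M` in its completion; its complement is the ideal set. -/
def interiorPart (dev : M → EuclideanSpace ℝ (Fin n)) : Set (DevCompletion dev) :=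
  range ((↑) : DevSpace dev → DevCompletion dev)

/-- The continuous extension of the developing map to the completion. -/
def devExt (dev : M → EuclideanSpace ℝ (Fin n)) : DevCompletion dev → EuclideanSpace ℝ (Fin n) :=
  UniformSpace.Completion.extension (α := DevSpace dev) dev

theorem IsDevelopingMap.contMDiff [HasGroupoid M (affineGroupoid n)]
    {dev : M → EuclideanSpace ℝ (Fin n)} (h : IsDevelopingMap dev) : ContMDiff (𝓡 n) (𝓡 n) ∞ dev := by
  have := isManifold_of_affine (n := n) (M := M)
  intro x
  let c := chartAt (EuclideanSpace ℝ (Fin n)) x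
  obtain ⟨A, hA⟩ := h c (chart_mem_atlas _ x) (c x) (c.map_source (mem_chart_source _ x))
  have hx : x ∈ c.source := mem_chart_source _ x
  have h1 : ContMDiffAt (𝓡 n) (𝓡 n) ∞ c x :=
    contMDiffAt_of_mem_maximalAtlas (IsManifold.chart_mem_maximalAtlas x) hx
  have h2 : ContDiff ℝ ∞ A := 
    (⟨A.toAffineMap, A.toAffineMap.continuous_of_finiteDimensional⟩ : _ →ᴬ[ℝ] _).contDiff
  have h3 : ContMDiffAt (𝓡 n) (𝓡 n) ∞ (A ∘ c) x := h2.contMDiff.contMDiffAt.comp x h1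
  refine h3.congr_of_eventuallyEq ?_
  filter_upwards [(c.continuousAt hx).eventually hA, c.open_source.mem_nhds hx] with y h4 h5
  rw [c.left_inv h5] at h4
  exact h4

theorem edist_dev_le [HasGroupoid M (affineGroupoid n)]
    {dev : M → EuclideanSpace ℝ (Fin n)} (h : IsDevelopingMap dev) (x y : M) : edist (dev x) (dev y) ≤ devEDist dev x y := by
  rw [devEDist]
  let := devENorm dev
  apply le_of_forall_gt
  intro r hr
  obtain ⟨γ, h0, h1, hγ, hl⟩ := Manifold.exists_lt_of_riemannianEDist_lt hr
  refine lt_of_le_of_lt ?_ hl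
  have hc : ContMDiffOn 𝓘(ℝ, ℝ) (𝓡 n) 1 (dev ∘ γ) (Icc 0 1) :=
    (h.contMDiff.of_le (by norm_cast)).comp_contMDiffOn hγ
  have e1 : edist (dev x) (dev y) ≤ ∫⁻ t in Icc (0:ℝ) 1, ‖derivWithin (dev ∘ γ) (Icc 0 1) t‖ₑ := by
    rw [← h0, ← h1, edist_comm, edist_eq_enorm_sub]
    exact enorm_sub_le_lintegral_derivWithin_Icc_of_contDiffOn_Icc hc.contDiffOn zero_le_one
  refine e1.trans (le_of_eq ?_)
  rw [Manifold.pathELength_eq_lintegral_mfderivWithin_Icc]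
  apply MeasureTheory.setLIntegral_congr_fun measurableSet_Icc
  intro t ht
  have hd : MDifferentiableAt (𝓡 n) (𝓡 n) dev (γ t) := h.contMDiff.mdifferentiableAt (by simp)
  have := mfderivWithin_comp t (I := 𝓘(ℝ, ℝ)) (I' := 𝓡 n) (I'' := 𝓡 n) (g := dev) (f := γ)
    (s := Icc (0 : ℝ) 1) (u := univ) hd.mdifferentiableWithinAt
    (hγ.mdifferentiableOn one_ne_zero t ht) (by simp)
    (uniqueMDiffWithinAt_iff_uniqueDiffWithinAt.2 (uniqueDiffOn_Icc zero_lt_one t ht))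
  have h2 : derivWithin (dev ∘ γ) (Icc 0 1) t = (mfderivWithin 𝓘(ℝ,ℝ) (𝓡 n) (dev ∘ γ) (Icc (0:ℝ) 1) t) (1:ℝ) := by
    rw [mfderivWithin_eq_fderivWithin]; rfl
  simp only [h2, this, mfderivWithin_univ]
  rfl

/-- The developing map is uniformly continuous for `devEDist`, so `devExt` does extend it. -/
theorem devExt_coe [HasGroupoid M (affineGroupoid n)]
    {dev : M → EuclideanSpace ℝ (Fin n)} (h : IsDevelopingMap dev) (x : M) :
    devExt dev ((show DevSpace dev from x : DevSpace dev) : DevCompletion dev) = dev x := by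
  refine UniformSpace.Completion.extension_coe (α := DevSpace dev) (f := dev) ?_ x
  exact (LipschitzWith.of_edist_le (α := DevSpace dev) fun x y => edist_dev_le h x y).uniformContinuous

/-! ## Convexity -/

/-- `A` is a `k`-simplex in the completion, developing onto the affine simplex `s`: it is compact,
the developing map embeds it onto `s`, and its interior lies in `M`. -/
structure IsSimplexOver (dev : M → EuclideanSpace ℝ (Fin n)) {k : ℕ}
    (s : Affine.Simplex ℝ (EuclideanSpace ℝ (Fin n)) k) (A : Set (DevCompletion dev)) : Prop where
  isCompact : IsCompact A
  isEmbedding : IsEmbedding (A.domRestrict (devExt dev))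
  image_eq : devExt dev '' A = s.closedInterior
  interior_subset : A ∩ devExt dev ⁻¹' s.interior ⊆ interiorPart dev

/-- `m`-convexity of a simply connected affine manifold with developing map `dev`: an
`(m+1)`-simplex of the completion whose interior and whose sides, except possibly one, do not meet
the ideal set, does not meet the ideal set. -/
def IsMConvex (m : ℕ) (dev : M → EuclideanSpace ℝ (Fin n)) : Prop :=
  ∀ (s : Affine.Simplex ℝ (EuclideanSpace ℝ (Fin n)) (m + 1)) (A : Set (DevCompletion dev)),
    IsSimplexOver dev s A → ∀ i : Fin (m + 2),
      (∀ j : Fin (m + 2), j ≠ i →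
        A ∩ devExt dev ⁻¹' (s.faceOpposite j).closedInterior ⊆ interiorPart dev) →
      A ⊆ interiorPart dev

end Develop

/-! ## Smooth embeddings, level sets, solid cylinders -/

section Embed

variable {E : Type*} [NormedAddCommGroup E] [NormedSpace ℝ E] {H : Type*} [TopologicalSpace H]
  (I : ModelWithCorners ℝ E H) {X : Type*} [TopologicalSpace X] [ChartedSpace H X]
  {E' : Type*} [NormedAddCommGroup E'] [NormedSpace ℝ E'] {H' : Type*} [TopologicalSpace H']
  (J : ModelWithCorners ℝ E' H') {Y : Type*} [TopologicalSpace Y] [ChartedSpace H' Y]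

/-- A smooth embedding: a smooth topological embedding with injective differentials. -/
structure IsSmoothEmb (φ : X → Y) : Prop where
  contMDiff : ContMDiff I J ∞ φ
  isEmbedding : IsEmbedding φ
  injective_mfderiv : ∀ x, Function.Injective (mfderiv I J φ x)

/-- `φ` is smooth on `X × [a, b]`, that is, on `X × U` for an open set `U ⊇ [a, b]` of `ℝ`
(only the values of `φ` on `X × [a, b]` matter below). -/
def IsSmoothOnBand (a b : ℝ) (φ : X × ℝ → Y) : Prop :=
  ∃ U : Set ℝ, IsOpen U ∧ Icc a b ⊆ U ∧
    ContMDiffOn (I.prod 𝓘(ℝ, ℝ)) J ∞ φ (univ ×ˢ U)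

end Embed

section Level

variable {M : Type*} [TopologicalSpace M] [ChartedSpace (EuclideanSpace ℝ (Fin 3)) M]

/-- The coordinate function `x₁` on `M`: the first coordinate of the developing map. -/
def height (dev : M → EuclideanSpace ℝ (Fin 3)) (p : M) : ℝ := dev p 0

/-- The level set `M_t`. -/
def level (dev : M → EuclideanSpace ℝ (Fin 3)) (t : ℝ) : Set M := {p | height dev p = t}

variable {E : Type*} [NormedAddCommGroup E] [NormedSpace ℝ E] {H : Type*} [TopologicalSpace H]
  (I : ModelWithCorners ℝ E H) {X : Type*} [TopologicalSpace X] [ChartedSpace H X]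

/-- `φ`, restricted to `X × [a, b]`, is transversal to every level set: at each point the image of
its differential and the tangent space `ker dx₁` of the level set span the tangent space of `M`. -/
def IsTransversalToLevels (dev : M → EuclideanSpace ℝ (Fin 3)) (a b : ℝ) (φ : X × ℝ → M) : Prop :=
  ∀ (x : X), ∀ t ∈ Icc a b,
    (mfderiv (I.prod 𝓘(ℝ, ℝ)) (𝓡 3) φ (x, t)).range ⊔
      (mfderiv (𝓡 3) 𝓘(ℝ, ℝ) (height dev) (φ (x, t))).ker = ⊤

/-- `Φ`, restricted to `Ω × [a, b]`, is a solid-cylinder embedding into `M`: a smooth embedding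
(injective differentials, topological embedding) mapping `Ω × {t}` into `M_t` for each `t`. -/
structure IsSolidCylinderEmb (dev : M → EuclideanSpace ℝ (Fin 3)) (a b : ℝ) (Φ : X × ℝ → M) :
    Prop where
  smooth : IsSmoothOnBand I (𝓡 3) a b Φ
  injective_mfderiv : ∀ (x : X), ∀ t ∈ Icc a b,
    Function.Injective (mfderiv (I.prod 𝓘(ℝ, ℝ)) (𝓡 3) Φ (x, t))
  isEmbedding : IsEmbedding ((univ ×ˢ Icc a b : Set (X × ℝ)).domRestrict Φ)
  level_preserving : ∀ (x : X), ∀ t ∈ Icc a b, Φ (x, t) ∈ level dev t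

end Level

end Drum

end

/-! ## Smooth dependence of local flows on initial conditions -/

/-! The cylinder is swept out by a flow. The velocities of the curves `t ↦ f (c, t)` extend to a
smooth field `V` on `M` with vertical speed identically `1`, equal to the vertical unit vector off a
compact set `N` that contains the whole band `f (δΩ × [a, b])` (`exists_extension_field`). Flowing
the cap `f'` along `σ V`, with `σ = 1` if `e = a` and `σ = -1` if `e = b`, preserves levels and
reproduces `f` on the boundary. Uniqueness of integral curves and reversal of the flow make the
result an embedding (`isSolidCylinderEmb_flowMap`), so all depends on the flow existing up to time
`b - a` on all of `Ω`. It is known to exist on the boundary only.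

Existence is proved in short time steps (`mem_flowDomain_of_boundary`). Points of the compact set
`N` can be moved for a uniform time, and off `N` the field is vertical. Hence over a short step the
flow exists as soon as the purely vertical flow does: follow the vertical line until it enters `N`,
then use the uniform time (`mem_flowDomain_of_eq_off`). Boundary points of the moving surface lie in
`N`, so their vertical flow causes no trouble.

Interior points are controlled by `2`-convexity (`mem_flowDomain_vert`). If vertical lines failed to
exist too early, one could minimise `s - ε ‖dev (S x)‖²` over the compact set of failing pairs. The
failing set then lies on or above a strictly convex paraboloid which it touches at a point `z₀`, so
near `z₀` everything on or below the tangent plane, except `z₀` itself, is reached by the flow. A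
small tetrahedron below this plane, with `z₀` in the relative interior of its top face, therefore
lifts to the completion with only `z₀` possibly ideal. By `2`-convexity `z₀` is not ideal either
(`exists_chart_of_halfBall`), so the vertical line continues through it, a contradiction.

The flow is treated as a relation between points of `M`, with derivatives measured through the
developing map. Its smoothness comes from the inverse function theorem on a Banach space of paths
(`exists_smooth_local_flow`), propagated along integral curves (`smooth_flowMap_aux`). -/

namespace Drum

/-! ### Smoothness of composition operators on spaces of continuous maps. -/

section Nemytskii

universe u

variable {K : Type*} [TopologicalSpace K] [CompactSpace K]

/-- Pointwise application of a continuous family of continuous linear maps, as a bilinear map. -/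
noncomputable def pointwiseApply (K : Type*) [TopologicalSpace K] [CompactSpace K] (E F : Type*)
    [NormedAddCommGroup E] [NormedSpace ℝ E]
    [NormedAddCommGroup F] [NormedSpace ℝ F] :
    C(K, E →L[ℝ] F) →L[ℝ] C(K, E) →L[ℝ] C(K, F) :=
  LinearMap.mkContinuous₂
    (LinearMap.mk₂ ℝ (fun (A : C(K, E →L[ℝ] F)) (h : C(K, E)) =>
        (⟨fun k => A k (h k), by fun_prop⟩ : C(K, F)))
      (fun A B h => by ext k; simp) (fun c A h => by ext k; simp)
      (fun A h h' => by ext k; simp) (fun c A h => by ext k; simp)) 1 (by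
      intro A h
      rw [ContinuousMap.norm_le _ (by positivity)]
      intro k
      rw [one_mul]
      refine ((A k).le_opNorm (h k)).trans ?_
      gcongr
      · exact A.norm_coe_le_norm k
      · exact h.norm_coe_le_norm k)

theorem pointwiseApply_apply {E F : Type*}
    [NormedAddCommGroup E] [NormedSpace ℝ E]
    [NormedAddCommGroup F] [NormedSpace ℝ F] (A : C(K, E →L[ℝ] F)) (h : C(K, E)) (k : K) :
    pointwiseApply K E F A h k = A k (h k) := rfl

/-- The range of `γ` is compact, so `g'` is uniformly close to `g' (γ k)` on a ball around `γ k`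
whose radius does not depend on `k`. The mean value inequality on these balls gives the remainder
estimate in the supremum norm. -/
theorem hasFDerivAt_comp_continuousMap {E F : Type*}
    [NormedAddCommGroup E] [NormedSpace ℝ E] [NormedAddCommGroup F] [NormedSpace ℝ F]
    (g : C(E, F)) (g' : C(E, E →L[ℝ] F)) (hg : ∀ x, HasFDerivAt g (g' x) x) (γ : C(K, E)) :
    HasFDerivAt (fun γ : C(K, E) => g.comp γ) (pointwiseApply K E F (g'.comp γ)) γ := by
  rw [hasFDerivAt_iff_isLittleO_nhds_zero, Asymptotics.isLittleO_iff]
  intro c hc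
  have hK : IsCompact (range γ) := isCompact_range γ.continuous
  have h1 := hK.uniformContinuousAt_of_continuousAt g' (fun x _ => g'.continuous.continuousAt)
    (Metric.dist_mem_uniformity hc)
  obtain ⟨δ, hδ, h2⟩ := Metric.mem_uniformity_dist.1 h1
  filter_upwards [Metric.ball_mem_nhds (0 : C(K, E)) hδ] with h hh
  rw [mem_ball_zero_iff] at hh
  rw [ContinuousMap.norm_le _ (by positivity)]
  intro k
  have hconv : Convex ℝ (Metric.ball (γ k) δ) := convex_ball _ _
  have hk : ‖h k‖ < δ := (h.norm_coe_le_norm k).trans_lt hh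
  have h3 := hconv.norm_image_sub_le_of_norm_hasFDerivWithin_le' (f := g) (f' := g')
    (φ := g' (γ k)) (C := c) (x := γ k) (y := γ k + h k)
    (fun x _ => (hg x).hasFDerivWithinAt)
    (fun x hx => by
      have := h2 (a := γ k) (b := x) (by rw [dist_comm]; exact hx) (mem_range_self k)
      rw [← dist_eq_norm, dist_comm]
      exact le_of_lt this)
    (Metric.mem_ball_self hδ) (by simpa [dist_eq_norm] using hk)
  simp only [add_sub_cancel_left] at h3
  simp only [ContinuousMap.sub_apply, ContinuousMap.comp_apply, ContinuousMap.add_apply,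
    pointwiseApply_apply]
  exact h3.trans (mul_le_mul_of_nonneg_left (h.norm_coe_le_norm k) hc.le)

/-- The derivative is again a composition operator, with `g'` in place of `g`, followed by a bounded
bilinear map; hence the induction varies the target `F`. Taking `E` and `F` in one universe keeps `E
→L[ℝ] F` among the admissible targets. -/
theorem contDiff_comp_continuousMap_nat (n : ℕ) {E F : Type u}
    [NormedAddCommGroup E] [NormedSpace ℝ E] [NormedAddCommGroup F] [NormedSpace ℝ F]
    (g : C(E, F)) (hg : ContDiff ℝ n g) : ContDiff ℝ n (fun γ : C(K, E) => g.comp γ) := by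
  induction n generalizing F with
  | zero =>
    exact contDiff_zero.2 (ContinuousMap.continuous_postcomp g)
  | succ n ih =>
    have hg1 : Differentiable ℝ g := hg.differentiable (by simp)
    let g' : C(E, E →L[ℝ] F) := ⟨fderiv ℝ g, hg.continuous_fderiv (by simp)⟩
    have hg' : ContDiff ℝ n g' := hg.fderiv_right (m := n) (by push_cast; exact le_rfl)
    rw [Nat.cast_add, Nat.cast_one, contDiff_succ_iff_hasFDerivAt]
    exact ⟨_, (pointwiseApply K E F).contDiff.comp (ih g' hg'),
      hasFDerivAt_comp_continuousMap g g' (fun x => (hg1 x).hasFDerivAt)⟩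

theorem contDiff_comp_continuousMap {E F : Type u}
    [NormedAddCommGroup E] [NormedSpace ℝ E] [NormedAddCommGroup F] [NormedSpace ℝ F]
    (g : C(E, F)) (hg : ContDiff ℝ ∞ g) : ContDiff ℝ ∞ (fun γ : C(K, E) => g.comp γ) :=
  contDiff_infty.2 fun n => contDiff_comp_continuousMap_nat n g (hg.of_le (by exact_mod_cast le_top))

end Nemytskii

/-! ### The local flow of a smooth field, by the inverse function theorem on paths. -/

section Flow

open MeasureTheory

variable {E : Type} [NormedAddCommGroup E] [NormedSpace ℝ E]

/-- The primitive of a continuous path vanishing at `0`. -/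
noncomputable def primitive (E : Type) [NormedAddCommGroup E] [NormedSpace ℝ E] :
    C(Icc (0 : ℝ) 1, E) →L[ℝ] C(Icc (0 : ℝ) 1, E) :=
  LinearMap.mkContinuous
    { toFun := fun γ => ⟨fun t => ∫ r in (0 : ℝ)..t, IccExtend zero_le_one γ r,
        (intervalIntegral.continuous_primitive (fun a b =>
          (Continuous.Icc_extend' (h := zero_le_one) γ.continuous).intervalIntegrable a b) 0).comp
            continuous_subtype_val⟩
      map_add' := by
        intro γ δ
        ext t
        exact intervalIntegral.integral_add
          ((Continuous.Icc_extend' (h := zero_le_one) γ.continuous).intervalIntegrable _ _)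
          ((Continuous.Icc_extend' (h := zero_le_one) δ.continuous).intervalIntegrable _ _)
      map_smul' := by
        intro c γ
        ext t
        exact intervalIntegral.integral_smul c _ } 1 (by
    intro γ
    rw [ContinuousMap.norm_le _ (by positivity), one_mul]
    intro t
    refine (intervalIntegral.norm_integral_le_of_norm_le_const (C := ‖γ‖)
      fun r _ => γ.norm_coe_le_norm _).trans ?_
    rw [sub_zero, abs_of_nonneg t.2.1]
    exact mul_le_of_le_one_right (norm_nonneg _) t.2.2)
/-- The map whose zero fibres over `(x, s)` are the solutions `γ` of `γ' = s X(γ)`, `γ 0 = x`. -/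
noncomputable def shootingMap (X : C(E, E)) (z : (E × ℝ) × C(Icc (0 : ℝ) 1, E)) :
    (E × ℝ) × C(Icc (0 : ℝ) 1, E) :=
  (z.1, z.2 - ContinuousMap.const _ z.1.1 - z.1.2 • primitive E (X.comp z.2))

/-- Constant paths, as a continuous linear map. -/
noncomputable def constPath (E : Type) [NormedAddCommGroup E] [NormedSpace ℝ E] :
    E →L[ℝ] C(Icc (0 : ℝ) 1, E) :=
  LinearMap.mkContinuous
    { toFun := fun x => ContinuousMap.const _ x
      map_add' := fun _ _ => rfl
      map_smul' := fun _ _ => rfl } 1 (by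
    intro x
    rw [ContinuousMap.norm_le _ (by positivity), one_mul]
    exact fun _ => le_rfl)

theorem contDiff_shootingMap (X : C(E, E)) (hX : ContDiff ℝ ∞ X) :
    ContDiff ℝ ∞ (shootingMap X) := by
  have h1 : ContDiff ℝ ∞ fun z : (E × ℝ) × C(Icc (0 : ℝ) 1, E) => constPath E z.1.1 :=
    (constPath E).contDiff.comp (contDiff_fst.comp contDiff_fst)
  have h2 : ContDiff ℝ ∞ fun z : (E × ℝ) × C(Icc (0 : ℝ) 1, E) => primitive E (X.comp z.2) :=
    (primitive E).contDiff.comp ((contDiff_comp_continuousMap X hX).comp contDiff_snd)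
  exact contDiff_fst.prodMk ((contDiff_snd.sub h1).sub ((contDiff_snd.comp contDiff_fst).smul h2))

/-- At `s = 0` the integral term contributes only through the variation of `s`, so the derivative is
block triangular with identities on the diagonal. -/
theorem hasFDerivAt_shootingMap (X : C(E, E)) (hX : ContDiff ℝ ∞ X) (x : E) :
    ∃ e : ((E × ℝ) × C(Icc (0 : ℝ) 1, E)) ≃L[ℝ] ((E × ℝ) × C(Icc (0 : ℝ) 1, E)),
      HasFDerivAt (shootingMap X) (e : _ →L[ℝ] _) ((x, 0), ContinuousMap.const _ x) := by
  set γ₀ : C(Icc (0 : ℝ) 1, E) := ContinuousMap.const _ x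
  set z₀ : (E × ℝ) × C(Icc (0 : ℝ) 1, E) := ((x, 0), γ₀)
  let f : (E × ℝ) →L[ℝ] C(Icc (0 : ℝ) 1, E) :=
    - (constPath E).comp (ContinuousLinearMap.fst ℝ E ℝ) -
      (ContinuousLinearMap.snd ℝ E ℝ).smulRight (primitive E (X.comp γ₀))
  refine ⟨(ContinuousLinearEquiv.refl ℝ _).skewProd (ContinuousLinearEquiv.refl ℝ _) f, ?_⟩
  have h2 : ContDiff ℝ ∞ fun z : (E × ℝ) × C(Icc (0 : ℝ) 1, E) => primitive E (X.comp z.2) :=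
    (primitive E).contDiff.comp ((contDiff_comp_continuousMap X hX).comp contDiff_snd)
  have h2' := (h2.differentiable (by simp) z₀).hasFDerivAt
  have h3 : HasFDerivAt (fun z : (E × ℝ) × C(Icc (0 : ℝ) 1, E) => z.1.2)
    ((ContinuousLinearMap.snd ℝ E ℝ).comp (ContinuousLinearMap.fst ℝ _ _)) z₀ :=
      ((ContinuousLinearMap.snd ℝ E ℝ).comp
        (ContinuousLinearMap.fst ℝ (E × ℝ) C(Icc (0 : ℝ) 1, E))).hasFDerivAt (x := z₀)
  have h1 : HasFDerivAt (fun z : (E × ℝ) × C(Icc (0 : ℝ) 1, E) => constPath E z.1.1)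
    ((constPath E).comp ((ContinuousLinearMap.fst ℝ E ℝ).comp (ContinuousLinearMap.fst ℝ _ _))) z₀ :=
      ((constPath E).comp
        ((ContinuousLinearMap.fst ℝ E ℝ).comp
          (ContinuousLinearMap.fst ℝ (E × ℝ) C(Icc (0 : ℝ) 1, E)))).hasFDerivAt (x := z₀)
  have h := (hasFDerivAt_fst (𝕜 := ℝ) (p := z₀)).prodMk
    (((hasFDerivAt_snd (𝕜 := ℝ) (p := z₀)).sub h1).sub (h3.smul h2'))
  convert! h using 1
  apply ContinuousLinearMap.ext
  rintro ⟨⟨y, s⟩, δ⟩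
  refine Prod.ext rfl ?_
  simp [f, z₀, ContinuousLinearEquiv.skewProd_apply]
  abel

/-- Invertibility of the derivative is an open condition, so one inverse is smooth at the images of
all points near the constant path, not just at the central one. -/
theorem exists_smooth_shooting_inverse [CompleteSpace E] (X : C(E, E)) (hX : ContDiff ℝ ∞ X)
    (x : E) : ∃ N ∈ 𝓝 (((x, 0), ContinuousMap.const _ x) : (E × ℝ) × C(Icc (0 : ℝ) 1, E)),
      ∃ inv : (E × ℝ) × C(Icc (0 : ℝ) 1, E) → (E × ℝ) × C(Icc (0 : ℝ) 1, E),
        ∀ z ∈ N, inv (shootingMap X z) = z ∧ ContDiffAt ℝ ∞ inv (shootingMap X z) := by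
  have hc := contDiff_shootingMap X hX
  obtain ⟨e, he⟩ := hasFDerivAt_shootingMap X hX x
  set z₀ : (E × ℝ) × C(Icc (0 : ℝ) 1, E) := ((x, 0), ContinuousMap.const _ x)
  let h := hc.contDiffAt.toOpenPartialHomeomorph (shootingMap X) he (by simp)
  have hz₀ : z₀ ∈ h.source := hc.contDiffAt.mem_toOpenPartialHomeomorph_source he (by simp)
  have h1 : ∀ᶠ z in 𝓝 z₀, fderiv ℝ (shootingMap X) z ∈
      range ((↑) : (((E × ℝ) × C(Icc (0 : ℝ) 1, E)) ≃L[ℝ] ((E × ℝ) × C(Icc (0 : ℝ) 1, E))) →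
        _ →L[ℝ] _) := by
    refine (hc.continuous_fderiv (by simp)).continuousAt.eventually ?_
    rw [he.fderiv]
    exact ContinuousLinearEquiv.nhds e
  refine ⟨_, Filter.inter_mem (h.open_source.mem_nhds hz₀) h1, h.symm, ?_⟩
  rintro z ⟨hz, e', he'⟩
  refine ⟨h.left_inv hz, ?_⟩
  have hz' : h z = shootingMap X z := rfl
  rw [← hz']
  refine h.contDiffAt_symm (f₀' := e') (h.map_source hz) ?_ hc.contDiffAt
  rw [h.left_inv hz, he']
  exact (hc.differentiable (by simp) z).hasFDerivAt

/-- The local flow of a smooth vector field is smooth in time and initial condition. -/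
theorem exists_smooth_local_flow [CompleteSpace E] (X : E → E) (hX : ContDiff ℝ ∞ X) (x₀ : E) :
    ∃ α : E × ℝ → E, ∃ r > 0, ContDiffOn ℝ ∞ α (Metric.ball x₀ r ×ˢ Ioo (-r) r) ∧
      ∀ x ∈ Metric.ball x₀ r, α (x, 0) = x ∧
        ∀ t ∈ Ioo (-r) r, HasDerivAt (fun t => α (x, t)) (X (α (x, t))) t := by
  obtain ⟨ε, hε, a, ρ, L, K, hρ, hpl⟩ :=
    IsPicardLindelof.of_contDiffAt_one ((hX.of_le (by simp)).contDiffAt (x := x₀))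
  obtain ⟨α, hα, hαc⟩ := (hpl 0).exists_forall_mem_closedBall_eq_hasDerivWithinAt_continuousOn
  simp only [zero_sub, zero_add] at hα hαc
  obtain ⟨N, hN, inv, hinv⟩ := exists_smooth_shooting_inverse ⟨X, hX.continuous⟩ hX x₀
  have hρ' : (0 : ℝ) < ρ := by exact_mod_cast hρ
  have hder : ∀ x ∈ Metric.closedBall x₀ (ρ : ℝ), ∀ t ∈ Ioo (-ε) ε,
      HasDerivAt (fun t => α (x, t)) (X (α (x, t))) t := fun x hx t ht =>
    ((hα x hx).2 t (Ioo_subset_Icc_self ht)).hasDerivAt (Icc_mem_nhds ht.1 ht.2)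
  obtain ⟨N₁, hN₁, N₂, hN₂, hN₁₂⟩ := mem_nhds_prod_iff.1 hN
  obtain ⟨δ, hδ, hδN⟩ := Metric.mem_nhds_iff.1 hN₂
  have hcα : ContinuousAt α (x₀, 0) := hαc.continuousAt (prod_mem_nhds
    (Metric.closedBall_mem_nhds _ hρ') (Icc_mem_nhds (by linarith) hε))
  have hα0 : α (x₀, 0) = x₀ := (hα x₀ (Metric.mem_closedBall_self hρ'.le)).1
  -- Half of `δ`, because the supremum over the path turns the pointwise bound into a non-strict
  -- one.
  obtain ⟨η, hη, hη'⟩ := Metric.continuousAt_iff.1 hcα (δ / 2) (by positivity)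
  rw [hα0] at hη'
  obtain ⟨η₂, hη₂, hη₂'⟩ := Metric.mem_nhds_iff.1 hN₁
  let r := min (min η η₂) (min ρ ε)
  have hr : 0 < r := by positivity
  have hr1 : r ≤ η := (min_le_left _ _).trans (min_le_left _ _)
  have hr2 : r ≤ η₂ := (min_le_left _ _).trans (min_le_right _ _)
  have hr3 : r ≤ ρ := (min_le_right _ _).trans (min_le_left _ _)
  have hr4 : r ≤ ε := (min_le_right _ _).trans (min_le_right _ _)
  have hball : ∀ x ∈ Metric.ball x₀ r, x ∈ Metric.closedBall x₀ (ρ : ℝ) := fun x hx =>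
    Metric.ball_subset_closedBall (Metric.ball_subset_ball hr3 hx)
  have hscale : ∀ s ∈ Ioo (-r) r, ∀ t ∈ Icc (0 : ℝ) 1, s * t ∈ Ioo (-r) r := by
    intro s hs t ht
    rw [mem_Ioo, ← abs_lt] at hs ⊢
    rw [abs_mul, abs_of_nonneg ht.1]
    exact (mul_le_of_le_one_right (abs_nonneg _) ht.2).trans_lt hs
  -- The solution rescaled to unit time, `t ↦ α (x, s t)`, is close to the constant path at `x₀` and
  -- is a zero of the second component of the shooting map. The local inverse at `(p, 0)` must
  -- therefore return it.
  have key : ∀ p ∈ Metric.ball x₀ r ×ˢ Ioo (-r) r,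
      ∃ γ : C(Icc (0 : ℝ) 1, E), (∀ t : Icc (0 : ℝ) 1, γ t = α (p.1, p.2 * t)) ∧
        (p, γ) ∈ N ∧ shootingMap ⟨X, hX.continuous⟩ (p, γ) = (p, 0) := by
    rintro ⟨x, s⟩ ⟨hx, hs⟩
    have hx' := hball x hx
    have hcont : ContinuousOn (fun t : ℝ => α (x, s * t)) (Icc 0 1) := by
      intro t ht
      have h1 := hder x hx' (s * t) (Ioo_subset_Ioo (by linarith) hr4 (hscale s hs t ht))
      exact (h1.continuousAt.comp (f := fun t => s * t)
        (by fun_prop : ContinuousAt (fun t => s * t) t)).continuousWithinAt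
    refine ⟨⟨fun t => α (x, s * t), continuousOn_iff_continuous_domRestrict.1 hcont⟩,
      fun t => rfl, hN₁₂ ⟨hη₂' ?_, hδN ?_⟩, ?_⟩
    · rw [← ball_prod_same]
      refine ⟨Metric.ball_subset_ball hr2 hx, ?_⟩
      rw [mem_ball_zero_iff, Real.norm_eq_abs, abs_lt]
      exact Ioo_subset_Ioo (by linarith) hr2 hs
    · rw [Metric.mem_ball]
      refine ((ContinuousMap.dist_le (by positivity : (0 : ℝ) ≤ δ / 2)).2 fun t => ?_).trans_lt
        (half_lt_self hδ)
      refine le_of_lt (hη' ?_)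
      rw [Prod.dist_eq]
      refine max_lt (lt_of_lt_of_le hx hr1) ?_
      rw [Real.dist_eq, sub_zero, abs_lt]
      exact Ioo_subset_Ioo (by linarith) hr1 (hscale s hs t t.2)
    · refine Prod.ext rfl (ContinuousMap.ext fun t => ?_)
      have h1 : ∀ u ∈ uIcc (0 : ℝ) t, HasDerivAt (fun u => α (x, s * u))
          (s • X (α (x, s * u))) u := by
        intro u hu
        rw [uIcc_of_le t.2.1] at hu
        have hu' : u ∈ Icc (0 : ℝ) 1 := ⟨hu.1, hu.2.trans t.2.2⟩
        have h1 := hder x hx' (s * u) (Ioo_subset_Ioo (by linarith) hr4 (hscale s hs u hu'))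
        have h2 : HasDerivAt (fun u => s * u) s u := by
          simpa using (hasDerivAt_id' u).const_mul s
        exact h1.scomp u h2
      have hint : ContinuousOn (fun u => s • X (α (x, s * u))) (uIcc (0 : ℝ) t) := by
        rw [uIcc_of_le t.2.1]
        exact ((hX.continuous.comp_continuousOn hcont).const_smul s).mono
          (Icc_subset_Icc_right t.2.2)
      have h2 := intervalIntegral.integral_eq_sub_of_hasDerivAt h1 hint.intervalIntegrable
      rw [intervalIntegral.integral_smul] at h2
      have h3 : ∫ u in (0 : ℝ)..t, IccExtend (zero_le_one' ℝ) (fun u : Icc (0 : ℝ) 1 =>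
          X (α (x, s * u))) u = ∫ u in (0 : ℝ)..t, X (α (x, s * u)) := by
        refine intervalIntegral.integral_congr fun u hu => ?_
        rw [uIcc_of_le t.2.1] at hu
        have hu' : u ∈ Icc (0 : ℝ) 1 := ⟨hu.1, hu.2.trans t.2.2⟩
        simp only [IccExtend_of_mem _ _ hu']
      have h4 : (shootingMap ⟨X, hX.continuous⟩ ((x, s),
          (⟨fun t => α (x, s * t), continuousOn_iff_continuous_domRestrict.1 hcont⟩ :
            C(Icc (0 : ℝ) 1, E)))).2 t = α (x, s * t) - x -
          s • ∫ u in (0 : ℝ)..t, IccExtend (zero_le_one' ℝ) (fun u : Icc (0 : ℝ) 1 =>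
          X (α (x, s * u))) u := rfl
      rw [h4, h3, h2, mul_zero, (hα x hx').1]
      simp
  refine ⟨α, r, hr, ?_, fun x hx => ⟨(hα x (hball x hx)).1, fun t ht =>
    hder x (hball x hx) t (Ioo_subset_Ioo (by linarith) hr4 ht)⟩⟩
  have hopen : IsOpen (Metric.ball x₀ r ×ˢ Ioo (-r) r) := Metric.isOpen_ball.prod isOpen_Ioo
  intro p hp
  refine ContDiffAt.contDiffWithinAt ?_
  obtain ⟨γ, -, hγN, hγs⟩ := key p hp
  have hsm : ContDiffAt ℝ ∞ inv (p, 0) := hγs ▸ (hinv _ hγN).2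
  let ev : C(Icc (0 : ℝ) 1, E) →L[ℝ] E := ContinuousMap.evalCLM ℝ ⟨1, by simp⟩
  -- Evaluating the path returned by the inverse at time `1` recovers `α (x, s)`, now as a smooth
  -- function of `(x, s)`.
  have h5 : ContDiffAt ℝ ∞ (fun p : E × ℝ => ev (inv (p, 0)).2) p :=
    ev.contDiff.contDiffAt.comp p (contDiffAt_snd.comp p
      (ContDiffAt.comp p (f := fun p : E × ℝ => (p, (0 : C(Icc (0 : ℝ) 1, E)))) hsm
        (contDiffAt_id.prodMk contDiffAt_const)))
  refine h5.congr_of_eventuallyEq ?_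
  filter_upwards [hopen.mem_nhds hp] with p' hp'
  obtain ⟨γ', hγ', hγN', hγs'⟩ := key p' hp'
  have h6 := (hinv _ hγN').1
  rw [hγs'] at h6
  rw [h6]
  change _ = γ' ⟨1, by simp⟩
  rw [hγ', mul_one]

end Flow

end Drum

/-! ## Developing charts -/

namespace Drum

section DevChart

variable {n : ℕ} {M : Type*} [TopologicalSpace M] [ChartedSpace (EuclideanSpace ℝ (Fin n)) M]
  [HasGroupoid M (affineGroupoid n)] {dev : M → EuclideanSpace ℝ (Fin n)}

theorem contDiff_affineEquiv
    (A : EuclideanSpace ℝ (Fin n) ≃ᵃ[ℝ] EuclideanSpace ℝ (Fin n)) : ContDiff ℝ ∞ A :=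
  (⟨A.toAffineMap, A.toAffineMap.continuous_of_finiteDimensional⟩ : _ →ᴬ[ℝ] _).contDiff

/-- Near every point a developing map is a chart with smooth inverse. -/
theorem IsDevelopingMap.exists_chart (hdev : IsDevelopingMap dev) (q : M) :
    ∃ h : OpenPartialHomeomorph M (EuclideanSpace ℝ (Fin n)), q ∈ h.source ∧ (∀ p, h p = dev p) ∧
      ContMDiffOn (𝓡 n) (𝓡 n) ∞ h.symm h.target := by
  have := isManifold_of_affine (n := n) (M := M)
  let c := chartAt (EuclideanSpace ℝ (Fin n)) q
  have hq : q ∈ c.source := mem_chart_source _ q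
  obtain ⟨A, hA⟩ := hdev c (chart_mem_atlas _ q) (c q) (c.map_source hq)
  obtain ⟨U, hU, hUo, hqU⟩ := eventually_nhds_iff.1 hA
  let Ah : EuclideanSpace ℝ (Fin n) ≃ₜ EuclideanSpace ℝ (Fin n) :=
    { toEquiv := A.toEquiv
      continuous_toFun := (contDiff_affineEquiv A).continuous
      continuous_invFun := (contDiff_affineEquiv A.symm).continuous }
  let d : OpenPartialHomeomorph M (EuclideanSpace ℝ (Fin n)) :=
    (c.restr (c ⁻¹' U)).transHomeomorph Ah
  have hopen : IsOpen (c.source ∩ c ⁻¹' U) := c.isOpen_inter_preimage hUo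
  have hds : d.source = c.source ∩ c ⁻¹' U := by
    change c.source ∩ interior (c ⁻¹' U) = _
    rw [← c.open_source.interior_eq, ← interior_inter, c.open_source.interior_eq,
      hopen.interior_eq]
  have he : EqOn dev d d.source := by
    intro p hp
    rw [hds] at hp
    have := hU (c p) hp.2
    rw [c.left_inv hp.1] at this
    exact this
  -- The underlying function is replaced by `dev` on all of `M`, so that `h p = dev p` needs no
  -- condition on `p`.
  let h : OpenPartialHomeomorph M (EuclideanSpace ℝ (Fin n)) :=
    { d with
      toFun := dev
      map_source' := fun _x hx => by rw [he hx]; exact d.map_source' hx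
      left_inv' := fun _x hx => by rw [he hx]; exact d.left_inv' hx
      right_inv' := fun _y hy => by rw [he (d.map_target' hy)]; exact d.right_inv' hy
      continuousOn_toFun := (continuousOn_congr he).mpr d.continuousOn_toFun }
  refine ⟨h, by change q ∈ d.source; rw [hds]; exact ⟨hq, hqU⟩, fun p => rfl, ?_⟩
  have hsymm : ∀ y, h.symm y = c.symm (A.symm y) := fun y => rfl
  have h1 : ContMDiffOn (𝓡 n) (𝓡 n) ∞ c.symm c.target :=
    contMDiffOn_symm_of_mem_maximalAtlas (IsManifold.chart_mem_maximalAtlas q)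
  refine (h1.comp (contDiff_affineEquiv A.symm).contMDiff.contMDiffOn (s := h.target) ?_).congr
    fun y _ => hsymm y
  intro y hy
  have hy' : y ∈ d.target := hy
  simp only [d, OpenPartialHomeomorph.transHomeomorph_target, mem_preimage,
    OpenPartialHomeomorph.restr_target] at hy'
  exact hy'.1

theorem IsDevelopingMap.continuous (hdev : IsDevelopingMap dev) : Continuous dev :=
  hdev.contMDiff.continuous

end DevChart

/-! ## Integral curves in terms of the developing map -/

section IntegralCurve

variable {n : ℕ} {M : Type*} [TopologicalSpace M]

/-- `γ` is, on `J`, an integral curve of the vector field whose development is `V`. -/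
def IsIC (dev : M → EuclideanSpace ℝ (Fin n)) (V : M → EuclideanSpace ℝ (Fin n)) (γ : ℝ → M)
    (J : Set ℝ) : Prop :=
  ∀ t ∈ J, ContinuousWithinAt γ J t ∧ HasDerivWithinAt (dev ∘ γ) (V (γ t)) J t

variable {dev : M → EuclideanSpace ℝ (Fin n)} {V : M → EuclideanSpace ℝ (Fin n)} {γ δ : ℝ → M}
  {J J' : Set ℝ}

theorem IsIC.mono (h : IsIC dev V γ J) (hJ : J' ⊆ J) : IsIC dev V γ J' := fun t ht =>
  ⟨(h t (hJ ht)).1.mono hJ, (h t (hJ ht)).2.mono hJ⟩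

theorem IsIC.congr (h : IsIC dev V γ J) (he : EqOn δ γ J) : IsIC dev V δ J := by
  intro t ht
  refine ⟨(h t ht).1.congr (fun s hs => he hs) (he ht), ?_⟩
  rw [he ht]
  exact (h t ht).2.congr (fun s hs => congrArg dev (he hs)) (congrArg dev (he ht))

theorem IsIC.continuousOn (h : IsIC dev V γ J) : ContinuousOn γ J := fun t ht => (h t ht).1

theorem IsIC.comp_add (h : IsIC dev V γ J) (c : ℝ) :
    IsIC dev V (fun t => γ (t + c)) ((fun t => t + c) ⁻¹' J) := by
  intro t ht
  have hc : ContinuousWithinAt (fun t : ℝ => t + c) ((fun t => t + c) ⁻¹' J) t := by fun_prop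
  refine ⟨(h (t + c) ht).1.comp (f := fun t => t + c) hc (mapsTo_preimage _ _), ?_⟩
  have h2 : HasDerivWithinAt (fun t : ℝ => t + c) 1 ((fun t => t + c) ⁻¹' J) t :=
    ((hasDerivAt_id' t).add_const c).hasDerivWithinAt
  have := (h (t + c) ht).2.scomp t h2 (mapsTo_preimage _ _)
  rwa [one_smul] at this
/-- Gluing of integral curves along overlapping open sets of times. -/
theorem IsIC.union (hJ : IsOpen J) (hJ' : IsOpen J') (h : IsIC dev V γ J) (h' : IsIC dev V γ J') :
    IsIC dev V γ (J ∪ J') := by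
  rintro t (ht | ht)
  · have h1 : J ∈ 𝓝 t := hJ.mem_nhds ht
    exact ⟨((h t ht).1.continuousAt h1).continuousWithinAt,
      ((h t ht).2.hasDerivAt h1).hasDerivWithinAt⟩
  · have h1 : J' ∈ 𝓝 t := hJ'.mem_nhds ht
    exact ⟨((h' t ht).1.continuousAt h1).continuousWithinAt,
      ((h' t ht).2.hasDerivAt h1).hasDerivWithinAt⟩

/-- Local uniqueness of integral curves, for intervals of any kind. -/
theorem ode_eqOn_of_lipschitzOnWith {E : Type*} [NormedAddCommGroup E] [NormedSpace ℝ E] {X : E → E}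
    {K : NNReal} {s : Set E} (hX : LipschitzOnWith K X s) {u w : ℝ → E} {J : Set ℝ}
    (hJ : J.OrdConnected) {t₀ : ℝ} (ht₀ : t₀ ∈ J)
    (hu : ∀ t ∈ J, HasDerivWithinAt u (X (u t)) J t ∧ u t ∈ s)
    (hw : ∀ t ∈ J, HasDerivWithinAt w (X (w t)) J t ∧ w t ∈ s) (h0 : u t₀ = w t₀) :
    EqOn u w J := by
  intro t ht
  rcases le_total t₀ t with h | h
  · have hss : Icc t₀ t ⊆ J := hJ.out ht₀ ht
    have hd : ∀ (u : ℝ → E), (∀ t ∈ J, HasDerivWithinAt u (X (u t)) J t ∧ u t ∈ s) →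
        ∀ r ∈ Ico t₀ t, HasDerivWithinAt u (X (u r)) (Ici r) r := fun u hu r hr =>
      ((hu r (hss (Ico_subset_Icc_self hr))).1.mono
        ((Icc_subset_Icc_left hr.1).trans hss)).mono_of_mem_nhdsWithin (Icc_mem_nhdsGE hr.2)
    exact ODE_solution_unique_of_mem_Icc_right (v := fun _ => X) (s := fun _ => s)
      (fun _ _ => hX) (fun r hr => ((hu r (hss hr)).1.mono hss).continuousWithinAt)
      (hd u hu) (fun r hr => (hu r (hss (Ico_subset_Icc_self hr))).2)
      (fun r hr => ((hw r (hss hr)).1.mono hss).continuousWithinAt)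
      (hd w hw) (fun r hr => (hw r (hss (Ico_subset_Icc_self hr))).2) h0 ⟨h, le_rfl⟩
  · have hss : Icc t t₀ ⊆ J := hJ.out ht ht₀
    have hd : ∀ (u : ℝ → E), (∀ t ∈ J, HasDerivWithinAt u (X (u t)) J t ∧ u t ∈ s) →
        ∀ r ∈ Ioc t t₀, HasDerivWithinAt u (X (u r)) (Iic r) r := fun u hu r hr =>
      ((hu r (hss (Ioc_subset_Icc_self hr))).1.mono
        ((Icc_subset_Icc_right hr.2).trans hss)).mono_of_mem_nhdsWithin (Icc_mem_nhdsLE hr.1)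
    exact ODE_solution_unique_of_mem_Icc_left (v := fun _ => X) (s := fun _ => s)
      (fun _ _ => hX) (fun r hr => ((hu r (hss hr)).1.mono hss).continuousWithinAt)
      (hd u hu) (fun r hr => (hu r (hss (Ioc_subset_Icc_self hr))).2)
      (fun r hr => ((hw r (hss hr)).1.mono hss).continuousWithinAt)
      (hd w hw) (fun r hr => (hw r (hss (Ioc_subset_Icc_self hr))).2) h0 ⟨le_rfl, h⟩

variable [ChartedSpace (EuclideanSpace ℝ (Fin n)) M] [HasGroupoid M (affineGroupoid n)]

/-- In a developing chart both curves solve an equation whose right-hand side is locally Lipschitz.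
Working within `J` covers endpoints of closed intervals too. -/
theorem IsIC.eventually_eq (hdev : IsDevelopingMap dev) (hV : ContMDiff (𝓡 n) (𝓡 n) ∞ V)
    (hJ : J.OrdConnected) (hγ : IsIC dev V γ J) (hδ : IsIC dev V δ J) {t₀ : ℝ} (ht₀ : t₀ ∈ J)
    (h0 : γ t₀ = δ t₀) : ∀ᶠ t in 𝓝[J] t₀, γ t = δ t := by
  obtain ⟨h, hq, hh, hsm⟩ := hdev.exists_chart (γ t₀)
  have hq' : h (γ t₀) ∈ h.target := h.map_source hq
  have h1 : ContDiffAt ℝ 1 (V ∘ h.symm) (h (γ t₀)) :=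
    ((hV.comp_contMDiffOn hsm).contMDiffAt (h.open_target.mem_nhds hq')).contDiffAt.of_le
      (by simp)
  obtain ⟨K, s, hs, hL⟩ := h1.exists_lipschitzOnWith
  have h2 : ∀ (γ : ℝ → M), IsIC dev V γ J → γ t₀ ∈ h.source → s ∈ 𝓝 (h (γ t₀)) →
      ∀ᶠ t in 𝓝[J] t₀, γ t ∈ h.source ∧ h (γ t) ∈ s := by
    intro γ hγ h3 h4
    exact (hγ t₀ ht₀).1.eventually (Filter.Eventually.and (h.open_source.mem_nhds h3)
      ((h.continuousAt h3).eventually h4))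
  have h3 := (h2 γ hγ hq hs).and (h2 δ hδ (h0 ▸ hq) (h0 ▸ hs))
  rw [eventually_nhdsWithin_iff] at h3
  obtain ⟨ε, hε, h4⟩ := Metric.eventually_nhds_iff_ball.1 h3
  rw [Real.ball_eq_Ioo] at h4
  have hsub : J ∩ Ioo (t₀ - ε) (t₀ + ε) ⊆ J := inter_subset_left
  have hmem : t₀ ∈ J ∩ Ioo (t₀ - ε) (t₀ + ε) := ⟨ht₀, by constructor <;> linarith⟩
  have h5 := ode_eqOn_of_lipschitzOnWith hL (u := dev ∘ γ) (w := dev ∘ δ)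
    (J := J ∩ Ioo (t₀ - ε) (t₀ + ε)) (hJ.inter ordConnected_Ioo) hmem
    (fun t ht => by
      have h6 := (h4 t ht.2 ht.1).1
      refine ⟨?_, by simpa [hh] using h6.2⟩
      have h7 := ((hγ t ht.1).2).mono hsub
      rw [Function.comp_apply, Function.comp_apply, ← hh, h.left_inv h6.1]
      exact h7)
    (fun t ht => by
      have h6 := (h4 t ht.2 ht.1).2
      refine ⟨?_, by simpa [hh] using h6.2⟩
      have h7 := ((hδ t ht.1).2).mono hsub
      rw [Function.comp_apply, Function.comp_apply, ← hh, h.left_inv h6.1]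
      exact h7)
    (congrArg dev h0)
  rw [eventually_nhdsWithin_iff]
  filter_upwards [Ioo_mem_nhds (by linarith : t₀ - ε < t₀) (by linarith : t₀ < t₀ + ε)] with t ht htJ
  refine h.injOn (h4 t ht htJ).1.1 (h4 t ht htJ).2.1 ?_
  rw [hh, hh]
  exact h5 ⟨htJ, ht⟩

/-- Agreement of the two curves is an open condition by local uniqueness, and disagreement is open
because `M` is Hausdorff; an interval is connected. -/
theorem IsIC.eqOn [T2Space M] (hdev : IsDevelopingMap dev) (hV : ContMDiff (𝓡 n) (𝓡 n) ∞ V)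
    (hJ : J.OrdConnected) (hγ : IsIC dev V γ J) (hδ : IsIC dev V δ J) {t₀ : ℝ} (ht₀ : t₀ ∈ J)
    (h0 : γ t₀ = δ t₀) : EqOn γ δ J := by
  intro t ht
  refine (hJ.isPreconnected.induction₂ (fun s t => γ s = δ s ↔ γ t = δ t) ?_ ?_ ?_ ht₀ ht).1 h0
  · intro x hx
    by_cases h : γ x = δ x
    · filter_upwards [hγ.eventually_eq hdev hV hJ hδ hx h] with y hy
      simp [h, hy]
    · have h1 := (((hγ x hx).1.prodMk (hδ x hx).1).tendsto.eventually
        (isClosed_diagonal.isOpen_compl.mem_nhds h))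
      filter_upwards [h1] with y hy
      exact iff_of_false h hy
  · exact fun x y z _ _ _ h1 h2 => h1.trans h2
  · exact fun x y _ _ h => h.symm

end IntegralCurve

/-! ## The flow relation -/

section Flow

variable {n : ℕ} {M : Type*} [TopologicalSpace M]

/-- The flow of the field with development `V`, as a relation: the integral curve
starting at `p` is at `q` at time `s`. -/
def Flow (dev : M → EuclideanSpace ℝ (Fin n)) (V : M → EuclideanSpace ℝ (Fin n)) (p : M) (s : ℝ)
    (q : M) : Prop :=
  ∃ (γ : ℝ → M) (J : Set ℝ), IsOpen J ∧ J.OrdConnected ∧ 0 ∈ J ∧ s ∈ J ∧ γ 0 = p ∧ γ s = q ∧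
    IsIC dev V γ J

/-- The points and times at which the flow is defined. -/
def flowDomain (dev : M → EuclideanSpace ℝ (Fin n)) (V : M → EuclideanSpace ℝ (Fin n)) :
    Set (M × ℝ) :=
  {z | ∃ q, Flow dev V z.1 z.2 q}

open Classical in
/-- The flow as a map, with a junk value off `flowDomain`. -/
noncomputable def flowMap (dev : M → EuclideanSpace ℝ (Fin n)) (V : M → EuclideanSpace ℝ (Fin n)) (z : M × ℝ) :
    M :=
  if h : ∃ q, Flow dev V z.1 z.2 q then h.choose else z.1

variable {dev : M → EuclideanSpace ℝ (Fin n)} {V : M → EuclideanSpace ℝ (Fin n)} {p q r : M}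
  {s t : ℝ}

theorem flow_flowMap {z : M × ℝ} (hz : z ∈ flowDomain dev V) :
    Flow dev V z.1 z.2 (flowMap dev V z) := by
  have hz' : ∃ q, Flow dev V z.1 z.2 q := hz
  rw [flowMap, dif_pos hz']
  exact hz'.choose_spec

theorem preimage_add_ordConnected {J : Set ℝ} (hJ : J.OrdConnected) (c : ℝ) :
    ((fun t => t + c) ⁻¹' J).OrdConnected :=
  ⟨fun x hx y hy z hz => hJ.out hx hy ⟨by linarith [hz.1], by linarith [hz.2]⟩⟩

theorem Flow.symm (h : Flow dev V p s q) : Flow dev V q (-s) p := by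
  obtain ⟨γ, J, hJ, hJc, h0, hs, hp, hq, hγ⟩ := h
  refine ⟨fun t => γ (t + s), (fun t => t + s) ⁻¹' J, hJ.preimage (by fun_prop),
    preimage_add_ordConnected hJc s, by simpa, by simpa, by simpa, by simpa, hγ.comp_add s⟩
theorem IsIC.flow {B : Set M} {η : ℝ} {Θ : M × ℝ → M}
    (hΘ : ∀ p ∈ B, Θ (p, 0) = p ∧ IsIC dev V (fun s => Θ (p, s)) (Ioo (-η) η)) {p : M} (hp : p ∈ B)
    {s : ℝ} (hs : s ∈ Ioo (-η) η) : Flow dev V p s (Θ (p, s)) :=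
  ⟨fun s => Θ (p, s), Ioo (-η) η, isOpen_Ioo, ordConnected_Ioo,
    by constructor <;> linarith [hs.1, hs.2], hs, (hΘ p hp).1, rfl, (hΘ p hp).2⟩

variable [ChartedSpace (EuclideanSpace ℝ (Fin n)) M] [HasGroupoid M (affineGroupoid n)]
  [T2Space M]

theorem Flow.unique (hdev : IsDevelopingMap dev) (hV : ContMDiff (𝓡 n) (𝓡 n) ∞ V)
    (h : Flow dev V p s q) (h' : Flow dev V p s r) : q = r := by
  obtain ⟨γ, J, hJ, hJc, h0, hs, hp, hq, hγ⟩ := h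
  obtain ⟨γ', J', hJ', hJc', h0', hs', hp', hq', hγ'⟩ := h'
  rw [← hq, ← hq']
  exact (hγ.mono inter_subset_left).eqOn hdev hV (hJc.inter hJc')
    (hγ'.mono inter_subset_right) ⟨h0, h0'⟩ (hp.trans hp'.symm) ⟨hs, hs'⟩

theorem Flow.unique_left (hdev : IsDevelopingMap dev) (hV : ContMDiff (𝓡 n) (𝓡 n) ∞ V)
    (h : Flow dev V p s r) (h' : Flow dev V q s r) : p = q :=
  h.symm.unique hdev hV h'.symm

theorem Flow.flowMap_eq (hdev : IsDevelopingMap dev) (hV : ContMDiff (𝓡 n) (𝓡 n) ∞ V)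
    (h : Flow dev V p s q) : flowMap dev V (p, s) = q :=
  (flow_flowMap (z := (p, s)) ⟨q, h⟩).unique hdev hV h

-- The second curve, shifted by `s`, agrees with the first on the overlap of their intervals by
-- uniqueness. The two thus glue to one integral curve on the union.
open Classical in
theorem Flow.trans (hdev : IsDevelopingMap dev) (hV : ContMDiff (𝓡 n) (𝓡 n) ∞ V)
    (h : Flow dev V p s q) (h' : Flow dev V q t r) : Flow dev V p (s + t) r := by
  obtain ⟨γ, J, hJ, hJc, h0, hs, hp, hq, hγ⟩ := h
  obtain ⟨γ', J', hJ', hJc', h0', ht, hq', hr, hγ'⟩ := h'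
  have hδ := hγ'.comp_add (-s)
  have hJ₂ : IsOpen ((fun t => t + -s) ⁻¹' J') := hJ'.preimage (by fun_prop)
  have hJc₂ := preimage_add_ordConnected hJc' (-s)
  have hs₂ : s ∈ (fun t => t + -s) ⁻¹' J' := by simpa
  have ht₂ : s + t ∈ (fun t => t + -s) ⁻¹' J' := by simpa
  have heq := (hγ.mono inter_subset_left).eqOn hdev hV (hJc.inter hJc₂)
    (hδ.mono inter_subset_right) (t₀ := s) ⟨hs, hs₂⟩ (by simp [hq, hq'])
  have e1 : EqOn (fun u => if u ∈ J then γ u else γ' (u + -s)) γ J := fun u hu => if_pos hu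
  have e2 : EqOn (fun u => if u ∈ J then γ u else γ' (u + -s)) (fun u => γ' (u + -s))
      ((fun t => t + -s) ⁻¹' J') := by
    intro u hu
    by_cases hu' : u ∈ J
    · exact (if_pos hu').trans (heq ⟨hu', hu⟩)
    · exact if_neg hu'
  refine ⟨fun u => if u ∈ J then γ u else γ' (u + -s), J ∪ (fun t => t + -s) ⁻¹' J',
    hJ.union hJ₂, ?_, Or.inl h0, Or.inr ht₂, (e1 h0).trans hp,
    (e2 ht₂).trans (by simpa using hr), (hγ.congr e1).union hJ hJ₂ (hδ.congr e2)⟩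
  exact (IsPreconnected.union s hs hs₂ hJc.isPreconnected hJc₂.isPreconnected).ordConnected

end Flow

/-! ## Local existence and smoothness -/

section LocalFlow

/-- Multiplication by a bump function makes a field on a chart domain global, as
`exists_smooth_local_flow` requires, without changing it near the point. -/
theorem exists_contDiff_eventuallyEq {E F : Type*} [NormedAddCommGroup E] [NormedSpace ℝ E]
    [FiniteDimensional ℝ E] [NormedAddCommGroup F] [NormedSpace ℝ F] {U : Set E} (hU : IsOpen U)
    {X : E → F} (hX : ContDiffOn ℝ ∞ X U) {y : E} (hy : y ∈ U) :
    ∃ Y : E → F, ContDiff ℝ ∞ Y ∧ Y =ᶠ[𝓝 y] X := by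
  obtain ⟨ε, hε, hεU⟩ := Metric.isOpen_iff.1 hU y hy
  let b : ContDiffBump y := ⟨ε / 4, ε / 2, by positivity, by linarith⟩
  refine ⟨fun z => b z • X z, contDiff_iff_contDiffAt.2 fun z => ?_, ?_⟩
  · by_cases hz : z ∈ tsupport b
    · rw [b.tsupport_eq] at hz
      have hzU : z ∈ U := hεU (Metric.closedBall_subset_ball (by
        change ε / 2 < ε; linarith) hz)
      exact b.contDiff.contDiffAt.smul (hX.contDiffAt (hU.mem_nhds hzU))
    · have : (fun z => b z • X z) =ᶠ[𝓝 z] fun _ => 0 := by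
        filter_upwards [(isClosed_tsupport b).isOpen_compl.mem_nhds hz] with w hw
        rw [image_eq_zero_of_notMem_tsupport hw, zero_smul]
      exact contDiffAt_const.congr_of_eventuallyEq this
  · filter_upwards [b.eventuallyEq_one] with z hz
    rw [hz, Pi.one_apply, one_smul]

variable {n : ℕ} {M : Type*} [TopologicalSpace M] [ChartedSpace (EuclideanSpace ℝ (Fin n)) M]
  [HasGroupoid M (affineGroupoid n)] 
  {dev : M → EuclideanSpace ℝ (Fin n)} {V : M → EuclideanSpace ℝ (Fin n)}

theorem _root_.ContDiffAt.contMDiffAt_prod {E F : Type*} [NormedAddCommGroup E] [NormedSpace ℝ E]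
    [NormedAddCommGroup F] [NormedSpace ℝ F] {α : E × ℝ → F} {z : E × ℝ}
    (h : ContDiffAt ℝ ∞ α z) : ContMDiffAt (𝓘(ℝ, E).prod 𝓘(ℝ, ℝ)) 𝓘(ℝ, F) ∞ α z := by
  rw [← modelWithCornersSelf_prod, chartedSpaceSelf_prod]
  exact h.contMDiffAt

theorem exists_local_flow (hdev : IsDevelopingMap dev) (hV : ContMDiff (𝓡 n) (𝓡 n) ∞ V) (q : M) :
    ∃ B : Set M, IsOpen B ∧ q ∈ B ∧ ∃ η > 0, ∃ Θ : M × ℝ → M,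
      ContMDiffOn ((𝓡 n).prod 𝓘(ℝ, ℝ)) (𝓡 n) ∞ Θ (B ×ˢ Ioo (-η) η) ∧
      ∀ p ∈ B, Θ (p, 0) = p ∧ IsIC dev V (fun s => Θ (p, s)) (Ioo (-η) η) := by
  obtain ⟨h, hq, hh, hsm⟩ := hdev.exists_chart q
  have hq' : h q ∈ h.target := h.map_source hq
  obtain ⟨Y, hY, hYX⟩ := exists_contDiff_eventuallyEq h.open_target
    (hV.comp_contMDiffOn hsm).contDiffOn hq'
  obtain ⟨α, r, hr, hα, hα'⟩ := exists_smooth_local_flow Y hY (h q)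
  have hα0 : α (h q, 0) = h q := (hα' _ (Metric.mem_ball_self hr)).1
  have hopen : IsOpen (Metric.ball (h q) r ×ˢ Ioo (-r) r) := Metric.isOpen_ball.prod isOpen_Ioo
  have hc : ContinuousAt α (h q, 0) := hα.continuousOn.continuousAt
    (hopen.mem_nhds ⟨Metric.mem_ball_self hr, by constructor <;> linarith⟩)
  have h1 : ∀ᶠ z in 𝓝 (h q, (0 : ℝ)), α z ∈ h.target ∧ Y (α z) = V (h.symm (α z)) := by
    have h1 : ∀ᶠ y in 𝓝 (α (h q, 0)), y ∈ h.target ∧ Y y = V (h.symm y) := by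
      rw [hα0]
      exact Filter.Eventually.and (h.open_target.mem_nhds hq') hYX
    exact hc.eventually h1
  obtain ⟨ε, hε, h2⟩ := Metric.eventually_nhds_iff_ball.1 h1
  obtain ⟨η, hη, hηε, hηr⟩ : ∃ η > 0, η ≤ ε ∧ η ≤ r :=
    ⟨min ε r, lt_min hε hr, min_le_left _ _, min_le_right _ _⟩
  have hη' : Ioo (-η) η ⊆ Ioo (-r) r := Ioo_subset_Ioo (neg_le_neg hηr) hηr
  have h3 : ∀ x ∈ Metric.ball (h q) η, ∀ t ∈ Ioo (-η) η,
      α (x, t) ∈ h.target ∧ Y (α (x, t)) = V (h.symm (α (x, t))) := by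
    intro x hx t ht
    refine h2 _ ?_
    rw [← ball_prod_same]
    refine ⟨Metric.ball_subset_ball hηε hx, ?_⟩
    rw [mem_ball_zero_iff, Real.norm_eq_abs, abs_lt]
    exact Ioo_subset_Ioo (neg_le_neg hηε) hηε ht
  have hball : ∀ x ∈ Metric.ball (h q) η, x ∈ Metric.ball (h q) r := fun x hx =>
    Metric.ball_subset_ball hηr hx
  have hcη : ∀ x ∈ Metric.ball (h q) η, ∀ t ∈ Ioo (-η) η, ContMDiffAt ((𝓡 n).prod 𝓘(ℝ, ℝ)) (𝓡 n) ∞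
      (fun z => h.symm (α z)) (x, t) := by
    intro x hx t ht
    have h4' : ContDiffAt ℝ ∞ α (x, t) := hα.contDiffAt (hopen.mem_nhds ⟨hball x hx, hη' ht⟩)
    have h4 := h4'.contMDiffAt_prod
    have h5 : ContMDiffAt (𝓡 n) (𝓡 n) ∞ h.symm (α (x, t)) :=
      hsm.contMDiffAt (h.open_target.mem_nhds (h3 x hx t ht).1)
    exact ContMDiffAt.comp (x, t) h5 h4
  refine ⟨h.source ∩ h ⁻¹' Metric.ball (h q) η, h.isOpen_inter_preimage Metric.isOpen_ball,
    ⟨hq, Metric.mem_ball_self hη⟩, η, hη, fun z => h.symm (α (h z.1, z.2)), ?_, ?_⟩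
  · rintro ⟨p, t⟩ ⟨⟨hp, hp'⟩, ht⟩
    have hd : ContMDiff (𝓡 n) (𝓡 n) ∞ h := by
      rw [show (h : M → EuclideanSpace ℝ (Fin n)) = dev from funext hh]
      exact hdev.contMDiff
    have h5 : ContMDiffAt ((𝓡 n).prod 𝓘(ℝ, ℝ)) ((𝓡 n).prod 𝓘(ℝ, ℝ)) ∞
        (fun z : M × ℝ => (h z.1, z.2)) (p, t) :=
      (hd.contMDiffAt.comp (p, t) contMDiffAt_fst).prodMk contMDiffAt_snd
    exact ((hcη (h p) hp' t ht).comp (p, t) h5).contMDiffWithinAt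
  · rintro p ⟨hp, hp'⟩
    refine ⟨by simp only [(hα' _ (hball _ hp')).1, h.left_inv hp], fun t ht => ⟨?_, ?_⟩⟩
    · have h6 : ContinuousAt (fun s => h.symm (α (h p, s))) t :=
        ((hcη (h p) hp' t ht).continuousAt).comp (f := fun s : ℝ => (h p, s)) (by fun_prop)
      exact h6.continuousWithinAt
    · have h7 := (hα' _ (hball _ hp')).2 t (hη' ht)
      rw [(h3 _ hp' t ht).2] at h7
      refine h7.hasDerivWithinAt.congr (fun s hs => ?_) ?_
      · change dev (h.symm (α (h p, s))) = _
        rw [← hh, h.right_inv (h3 _ hp' s hs).1]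
      · change dev (h.symm (α (h p, t))) = _
        rw [← hh, h.right_inv (h3 _ hp' t ht).1]

theorem Flow.refl (hdev : IsDevelopingMap dev) (hV : ContMDiff (𝓡 n) (𝓡 n) ∞ V) (q : M) :
    Flow dev V q 0 q := by
  obtain ⟨B, hB, hq, η, hη, Θ, -, hΘ⟩ := exists_local_flow hdev hV q
  have := IsIC.flow hΘ hq (s := 0) (by constructor <;> linarith)
  rwa [(hΘ q hq).1] at this

/-- The flow exists for a uniform time on compact sets. -/
theorem exists_uniform_flow_time (hdev : IsDevelopingMap dev) (hV : ContMDiff (𝓡 n) (𝓡 n) ∞ V)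
    {N : Set M} (hN : IsCompact N) :
    ∃ κ > 0, ∀ p ∈ N, ∀ s, 0 ≤ s → s ≤ κ → (p, s) ∈ flowDomain dev V := by
  refine hN.induction_on (p := fun N => ∃ κ > 0, ∀ p ∈ N, ∀ s, 0 ≤ s → s ≤ κ →
    (p, s) ∈ flowDomain dev V) ⟨1, one_pos, by simp⟩ ?_ ?_ ?_
  · intro s t hst h
    obtain ⟨κ, hκ, h⟩ := h
    exact ⟨κ, hκ, fun p hp => h p (hst hp)⟩
  · intro s t h1 h2
    obtain ⟨κ, hκ, h1⟩ := h1
    obtain ⟨κ', hκ', h2⟩ := h2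
    refine ⟨min κ κ', lt_min hκ hκ', ?_⟩
    rintro p (hp | hp) u hu hu'
    · exact h1 p hp u hu (hu'.trans (min_le_left _ _))
    · exact h2 p hp u hu (hu'.trans (min_le_right _ _))
  · intro q hq
    obtain ⟨B, hB, hqB, η, hη, Θ, -, hΘ⟩ := exists_local_flow hdev hV q
    refine ⟨B, mem_nhdsWithin_of_mem_nhds (hB.mem_nhds hqB), η / 2, by positivity,
      fun p hp s hs hs' => ⟨_, IsIC.flow hΘ hp ⟨by linarith, by linarith⟩⟩⟩

variable [T2Space M]

/-- An integral curve on a closed interval follows the flow. -/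
theorem IsIC.flow_Icc (hdev : IsDevelopingMap dev) (hV : ContMDiff (𝓡 n) (𝓡 n) ∞ V) {γ : ℝ → M}
    {s : ℝ} (hs : 0 ≤ s) (hγ : IsIC dev V γ (Icc 0 s)) : Flow dev V (γ 0) s (γ s) := by
  have h0 : (0 : ℝ) ∈ Icc 0 s := ⟨le_rfl, hs⟩
  have hs' : s ∈ Icc 0 s := ⟨hs, le_rfl⟩
  -- The relation `Flow` needs an open interval of times, which the closed interval does not provide
  -- at its ends. The local flow around each `γ t` supplies it, and composing flows forwards or
  -- backwards carries the assertion to neighbouring times.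
  refine (isPreconnected_Icc.induction₂ (fun t u => Flow dev V (γ 0) t (γ t) ↔
    Flow dev V (γ 0) u (γ u)) ?_ (fun x y z _ _ _ h1 h2 => h1.trans h2)
    (fun x y _ _ h => h.symm) h0 hs').1 (Flow.refl hdev hV _)
  intro t ht
  obtain ⟨B, hB, hq, η, hη, Θ, -, hΘ⟩ := exists_local_flow hdev hV (γ t)
  filter_upwards [inter_mem_nhdsWithin _ (Ioo_mem_nhds (by linarith : t - η < t)
    (by linarith : t < t + η))] with u hu
  have h1 := (hΘ _ hq).2.comp_add (-t)
  have hsub : Icc 0 s ∩ Ioo (t - η) (t + η) ⊆ (fun u => u + -t) ⁻¹' Ioo (-η) η := fun v hv =>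
    ⟨by linarith [hv.2.1], by linarith [hv.2.2]⟩
  have h2 := (hγ.mono inter_subset_left).eqOn hdev hV (ordConnected_Icc.inter ordConnected_Ioo)
    (h1.mono hsub) (t₀ := t) ⟨ht, by linarith, by linarith⟩ (by simp [(hΘ _ hq).1]) hu
  have h3 := IsIC.flow hΘ hq (s := u + -t) (hsub hu)
  dsimp only at h2
  rw [← h2] at h3
  refine ⟨fun h4 => ?_, fun h4 => ?_⟩
  · simpa using h4.trans hdev hV h3
  · simpa using h4.trans hdev hV h3.symm

/-- Near `(p, u)` the flow is the time `t` flow followed by a smooth local flow for time `u - t`.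
Openness of the domain and smoothness thus spread from time `0` along the compatible interval of the
integral curve. -/
theorem smooth_flowMap_aux (hdev : IsDevelopingMap dev) (hV : ContMDiff (𝓡 n) (𝓡 n) ∞ V)
    {p : M} {s : ℝ} (hz : (p, s) ∈ flowDomain dev V) :
    flowDomain dev V ∈ 𝓝 (p, s) ∧
      ContMDiffAt ((𝓡 n).prod 𝓘(ℝ, ℝ)) (𝓡 n) ∞ (flowMap dev V) (p, s) := by
  -- The bound `η` depends only on `q`, not on the starting time. The step can therefore be taken
  -- from `t` to `u` and from `u` to `t`, which gives the local equivalence needed for the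
  -- connectedness argument.
  have step : ∀ (q : M), ∃ B ∈ 𝓝 q, ∃ η > 0, ∀ t u : ℝ, |u - t| < η → ∀ r ∈ B,
      Flow dev V p t r → flowDomain dev V ∈ 𝓝 (p, t) →
      ContMDiffAt ((𝓡 n).prod 𝓘(ℝ, ℝ)) (𝓡 n) ∞ (flowMap dev V) (p, t) →
      flowDomain dev V ∈ 𝓝 (p, u) ∧
      ContMDiffAt ((𝓡 n).prod 𝓘(ℝ, ℝ)) (𝓡 n) ∞ (flowMap dev V) (p, u) := by
    intro q
    obtain ⟨B, hB, hq, η, hη, Θ, hΘs, hΘ⟩ := exists_local_flow hdev hV q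
    refine ⟨B, hB.mem_nhds hq, η, hη, fun t u hut r hr hF h1 h2 => ?_⟩
    rw [abs_lt] at hut
    have hι : ContMDiffAt ((𝓡 n).prod 𝓘(ℝ, ℝ)) ((𝓡 n).prod 𝓘(ℝ, ℝ)) ∞
        (fun z : M × ℝ => (z.1, t)) (p, u) := contMDiffAt_fst.prodMk contMDiffAt_const
    have h3 : ContMDiffAt ((𝓡 n).prod 𝓘(ℝ, ℝ)) (𝓡 n) ∞
        (fun z : M × ℝ => flowMap dev V (z.1, t)) (p, u) := ContMDiffAt.comp (p, u) h2 hι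
    have hr' : flowMap dev V (p, t) = r := hF.flowMap_eq hdev hV
    have h4 : ∀ᶠ z : M × ℝ in 𝓝 (p, u), (z.1, t) ∈ flowDomain dev V ∧ flowMap dev V (z.1, t) ∈ B ∧
        z.2 - t ∈ Ioo (-η) η := by
      refine (hι.continuousAt.eventually h1).and ((h3.continuousAt.eventually
        (hB.mem_nhds (by simpa [hr'] using hr))).and ?_)
      have : ContinuousAt (fun z : M × ℝ => z.2 - t) (p, u) := by fun_prop
      exact this.eventually (isOpen_Ioo.mem_nhds hut)
    have h5 : ∀ᶠ z : M × ℝ in 𝓝 (p, u),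
        Flow dev V z.1 z.2 (Θ (flowMap dev V (z.1, t), z.2 - t)) := by
      filter_upwards [h4] with z hz
      have := (flow_flowMap hz.1).trans hdev hV (IsIC.flow hΘ hz.2.1 hz.2.2)
      simpa using this
    refine ⟨h5.mono fun z hz => ⟨_, hz⟩, ?_⟩
    have h6 : ContMDiffAt ((𝓡 n).prod 𝓘(ℝ, ℝ)) (𝓡 n) ∞ Θ (r, u - t) :=
      hΘs.contMDiffAt ((hB.prod isOpen_Ioo).mem_nhds ⟨hr, hut⟩)
    have h7 : ContMDiffAt ((𝓡 n).prod 𝓘(ℝ, ℝ)) ((𝓡 n).prod 𝓘(ℝ, ℝ)) ∞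
        (fun z : M × ℝ => (flowMap dev V (z.1, t), z.2 - t)) (p, u) :=
      h3.prodMk (contMDiffAt_snd.sub contMDiffAt_const)
    have h8 := ContMDiffAt.comp (p, u) (g := Θ) (by simpa only [hr'] using h6) h7
    refine h8.congr_of_eventuallyEq ?_
    filter_upwards [h5] with z hz
    exact hz.flowMap_eq hdev hV
  have h0 : flowDomain dev V ∈ 𝓝 (p, (0 : ℝ)) ∧
      ContMDiffAt ((𝓡 n).prod 𝓘(ℝ, ℝ)) (𝓡 n) ∞ (flowMap dev V) (p, 0) := by
    obtain ⟨B, hB, hq, η, hη, Θ, hΘs, hΘ⟩ := exists_local_flow hdev hV p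
    have hm : B ×ˢ Ioo (-η) η ∈ 𝓝 (p, (0 : ℝ)) :=
      (hB.prod isOpen_Ioo).mem_nhds ⟨hq, by constructor <;> linarith⟩
    refine ⟨Filter.mem_of_superset hm fun z hz => ⟨_, IsIC.flow hΘ hz.1 hz.2⟩, ?_⟩
    refine (hΘs.contMDiffAt hm).congr_of_eventuallyEq ?_
    filter_upwards [hm] with z hz
    exact (IsIC.flow hΘ hz.1 hz.2).flowMap_eq hdev hV
  obtain ⟨_, γ, J, hJ, hJc, h0J, hs, hp, -, hγ⟩ := hz
  have hF : ∀ t ∈ J, Flow dev V p t (γ t) := fun t ht =>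
    ⟨γ, J, hJ, hJc, h0J, ht, hp, rfl, hγ⟩
  refine (hJc.isPreconnected.induction₂ (fun t u => (flowDomain dev V ∈ 𝓝 (p, t) ∧
      ContMDiffAt ((𝓡 n).prod 𝓘(ℝ, ℝ)) (𝓡 n) ∞ (flowMap dev V) (p, t)) ↔
      (flowDomain dev V ∈ 𝓝 (p, u) ∧
      ContMDiffAt ((𝓡 n).prod 𝓘(ℝ, ℝ)) (𝓡 n) ∞ (flowMap dev V) (p, u))) ?_
      (fun x y z _ _ _ h1 h2 => h1.trans h2) (fun x y _ _ h => h.symm) h0J hs).1 h0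
  intro t ht
  obtain ⟨B, hB, η, hη, h⟩ := step (γ t)
  have hη' : ∀ᶠ u in 𝓝[J] t, |u - t| < η := by
    refine nhdsWithin_le_nhds ?_
    filter_upwards [Metric.ball_mem_nhds t hη] with u hu
    simpa [Real.dist_eq] using hu
  filter_upwards [self_mem_nhdsWithin, (hγ t ht).1.eventually hB, hη'] with u huJ hu hut
  exact ⟨fun h1 => h t u hut _ (mem_of_mem_nhds hB) (hF t ht) h1.1 h1.2,
    fun h1 => h u t (by rwa [abs_sub_comm]) _ hu (hF u huJ) h1.1 h1.2⟩

theorem isOpen_flowDomain (hdev : IsDevelopingMap dev) (hV : ContMDiff (𝓡 n) (𝓡 n) ∞ V) :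
    IsOpen (flowDomain dev V) :=
  isOpen_iff_mem_nhds.2 fun _ hz => (smooth_flowMap_aux hdev hV hz).1

theorem contMDiffAt_flowMap (hdev : IsDevelopingMap dev) (hV : ContMDiff (𝓡 n) (𝓡 n) ∞ V)
    {z : M × ℝ} (hz : z ∈ flowDomain dev V) :
    ContMDiffAt ((𝓡 n).prod 𝓘(ℝ, ℝ)) (𝓡 n) ∞ (flowMap dev V) z :=
  (smooth_flowMap_aux hdev hV hz).2

end LocalFlow

end Drum

/-! ## A vector field extending the velocity of a family of curves -/

namespace Drum

/-- Immersions of open sets of vector spaces have smooth local left inverses. -/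
theorem exists_smooth_left_inverse {E F : Type*} [NormedAddCommGroup E] [NormedSpace ℝ E]
    [FiniteDimensional ℝ E] [NormedAddCommGroup F] [NormedSpace ℝ F] [FiniteDimensional ℝ F]
    {f : E → F} {O : Set E} (hO : IsOpen O) {z : E} (hz : z ∈ O) (hf : ContDiffOn ℝ ∞ f O)
    (hinj : Function.Injective (fderiv ℝ f z)) :
    ∃ W : Set F, IsOpen W ∧ f z ∈ W ∧ ∃ H : F → E, ContDiffOn ℝ ∞ H W ∧ MapsTo H W O ∧
      ∀ᶠ y in 𝓝 z, H (f y) = y := by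
  have := FiniteDimensional.complete ℝ E
  obtain ⟨P₀, hP₀⟩ := (fderiv ℝ f z).toLinearMap.exists_leftInverse_of_injective
    (LinearMap.ker_eq_bot.2 hinj)
  let P : F →L[ℝ] E := LinearMap.toContinuousLinearMap P₀
  have hfd : ∀ y ∈ O, HasFDerivAt f (fderiv ℝ f y) y := fun y hy =>
    ((hf.contDiffAt (hO.mem_nhds hy)).differentiableAt (by simp)).hasFDerivAt
  -- Composing with a linear left inverse `P` of the derivative makes the derivative at `z` the
  -- identity. If `h` inverts `g` locally, then `h.symm ∘ P` is a left inverse of `f` defined on an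
  -- open set of the target.
  let g : E → E := fun y => P (f y)
  have hg : ContDiffOn ℝ ∞ g O := P.contDiff.comp_contDiffOn hf
  have hgd : ∀ y ∈ O, HasFDerivAt g (P.comp (fderiv ℝ f y)) y := fun y hy =>
    P.hasFDerivAt.comp y (hfd y hy)
  have hgz : HasFDerivAt g ((ContinuousLinearEquiv.refl ℝ E : E ≃L[ℝ] E) : E →L[ℝ] E) z := by
    convert! hgd z hz using 1
    ext v
    exact (LinearMap.congr_fun hP₀ v).symm
  have hgc := hg.contDiffAt (hO.mem_nhds hz)
  let h := hgc.toOpenPartialHomeomorph g hgz (by simp)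
  have hzs : z ∈ h.source := hgc.mem_toOpenPartialHomeomorph_source hgz (by simp)
  have h1 : ∀ᶠ y in 𝓝 z, fderiv ℝ g y ∈ range ((↑) : (E ≃L[ℝ] E) → E →L[ℝ] E) := by
    refine (((hg.fderiv_of_isOpen (m := 0) hO (by simp)).continuousOn.continuousAt
      (hO.mem_nhds hz)).eventually ?_)
    rw [hgz.fderiv]
    exact ContinuousLinearEquiv.nhds _
  obtain ⟨N, hN, hNo, hzN⟩ := eventually_nhds_iff.1
    (h1.and (Filter.Eventually.and (p := (· ∈ h.source)) (q := (· ∈ O))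
      (h.open_source.mem_nhds hzs) (hO.mem_nhds hz)))
  have hNs : N ⊆ h.source := fun y hy => (hN y hy).2.1
  refine ⟨P ⁻¹' (h '' N), (h.isOpen_image_of_subset_source hNo hNs).preimage P.continuous,
    ⟨z, hzN, rfl⟩, fun y => h.symm (P y), ?_, ?_, ?_⟩
  · rintro y ⟨w, hw, hwy⟩
    obtain ⟨e, he⟩ := (hN w hw).1
    have h2 : h.symm (P y) = w := by rw [← hwy, h.left_inv (hNs hw)]
    have h3 : ContDiffAt ℝ ∞ h.symm (P y) := by
      refine h.contDiffAt_symm (f₀' := e) (hwy ▸ h.map_source (hNs hw)) ?_ ?_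
      · rw [h2, he]
        exact (hgd w (hN w hw).2.2).differentiableAt.hasFDerivAt
      · rw [h2]
        exact hg.contDiffAt (hO.mem_nhds (hN w hw).2.2)
    exact (h3.comp y P.contDiff.contDiffAt).contDiffWithinAt
  · rintro y ⟨w, hw, hwy⟩
    have h2 : h.symm (P y) = w := by rw [← hwy, h.left_inv (hNs hw)]
    change h.symm (P y) ∈ O
    rw [h2]
    exact (hN w hw).2.2
  · filter_upwards [hNo.mem_nhds hzN] with y hy
    exact h.left_inv (hNs hy)

theorem mfderiv_injective_of_eventually_leftInverse {E : Type*} [NormedAddCommGroup E]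
    [NormedSpace ℝ E] {H : Type*} [TopologicalSpace H] {I : ModelWithCorners ℝ E H} {X : Type*}
    [TopologicalSpace X] [ChartedSpace H X] {E' : Type*} [NormedAddCommGroup E'] [NormedSpace ℝ E']
    {H' : Type*} [TopologicalSpace H'] {J : ModelWithCorners ℝ E' H'} {Y : Type*}
    [TopologicalSpace Y] [ChartedSpace H' Y] {f : X → Y} {g : Y → X} {x : X}
    (hf : MDifferentiableAt I J f x) (hg : MDifferentiableAt J I g (f x))
    (h : ∀ᶠ y in 𝓝 x, g (f y) = y) : Function.Injective (mfderiv I J f x) := by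
  have h1 : mfderiv I I (g ∘ f) x = mfderiv I I id x :=
    Filter.EventuallyEq.mfderiv_eq (f := id) (h.mono fun y hy => hy)
  rw [mfderiv_comp x hg hf, mfderiv_id] at h1
  refine Function.LeftInverse.injective (g := mfderiv J I g (f x)) fun v => ?_
  exact DFunLike.congr_fun h1 v

section

variable {n : ℕ} {M : Type*} [TopologicalSpace M] [ChartedSpace (EuclideanSpace ℝ (Fin n)) M]
  [HasGroupoid M (affineGroupoid n)] {dev : M → EuclideanSpace ℝ (Fin n)}

theorem IsDevelopingMap.mfderiv_injective (hdev : IsDevelopingMap dev) (p : M) :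
    Function.Injective (mfderiv (𝓡 n) (𝓡 n) dev p) := by
  obtain ⟨h, hq, hh, hsm⟩ := hdev.exists_chart p
  have hp : dev p ∈ h.target := hh p ▸ h.map_source hq
  refine mfderiv_injective_of_eventually_leftInverse (g := h.symm)
    (hdev.contMDiff.mdifferentiable (by simp) p)
    ((hsm.contMDiffAt (h.open_target.mem_nhds hp)).mdifferentiableAt (by simp)) ?_
  filter_upwards [h.open_source.mem_nhds hq] with y hy
  rw [← hh, h.left_inv hy]

end

section Extension

variable {M : Type*} [TopologicalSpace M] [ChartedSpace (EuclideanSpace ℝ (Fin 3)) M]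
  [HasGroupoid M (affineGroupoid 3)] {dev : M → EuclideanSpace ℝ (Fin 3)}
  {C : Type*} [TopologicalSpace C] [ChartedSpace (EuclideanSpace ℝ (Fin 1)) C]
  [IsManifold (𝓡 1) ∞ C] {a b : ℝ} {f : C × ℝ → M}

/-- The family `f` in the chart of `C` at `c₀` and in the developing map. -/
noncomputable def familyInChart (dev : M → EuclideanSpace ℝ (Fin 3)) (f : C × ℝ → M) (c₀ : C)
    (z : EuclideanSpace ℝ (Fin 1) × ℝ) : EuclideanSpace ℝ (Fin 3) :=
  dev (f ((chartAt (EuclideanSpace ℝ (Fin 1)) c₀).symm z.1, z.2))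

theorem contDiffOn_familyInChart (hdev : IsDevelopingMap dev) {U : Set ℝ}
    (hf : ContMDiffOn ((𝓡 1).prod 𝓘(ℝ, ℝ)) (𝓡 3) ∞ f (univ ×ˢ U)) (c₀ : C) :
    ContDiffOn ℝ ∞ (familyInChart dev f c₀)
      ((chartAt (EuclideanSpace ℝ (Fin 1)) c₀).target ×ˢ U) := by
  set ψ := chartAt (EuclideanSpace ℝ (Fin 1)) c₀
  have h1 : ContMDiffOn (𝓡 1) (𝓡 1) ∞ ψ.symm ψ.target :=
    contMDiffOn_symm_of_mem_maximalAtlas (IsManifold.chart_mem_maximalAtlas c₀)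
  have h2 : ContMDiffOn ((𝓡 1).prod 𝓘(ℝ, ℝ)) ((𝓡 1).prod 𝓘(ℝ, ℝ)) ∞
      (fun z : EuclideanSpace ℝ (Fin 1) × ℝ => (ψ.symm z.1, z.2)) (ψ.target ×ˢ U) :=
    (h1.comp contMDiffOn_fst (fun z hz => hz.1)).prodMk contMDiffOn_snd
  have h3 := hdev.contMDiff.comp_contMDiffOn (hf.comp h2 (fun z hz => ⟨mem_univ _, hz.2⟩))
  rw [← modelWithCornersSelf_prod, chartedSpaceSelf_prod] at h3
  exact h3.contDiffOn

theorem hasDerivAt_familyInChart (hdev : IsDevelopingMap dev) {U : Set ℝ} (hU : IsOpen U)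
    (hf : ContMDiffOn ((𝓡 1).prod 𝓘(ℝ, ℝ)) (𝓡 3) ∞ f (univ ×ˢ U)) (c₀ : C)
    {c : C} (hc : c ∈ (chartAt (EuclideanSpace ℝ (Fin 1)) c₀).source) {t : ℝ} (ht : t ∈ U) :
    HasDerivAt (fun s => dev (f (c, s)))
      (fderiv ℝ (familyInChart dev f c₀) (chartAt (EuclideanSpace ℝ (Fin 1)) c₀ c, t) (0, 1)) t := by
  set ψ := chartAt (EuclideanSpace ℝ (Fin 1)) c₀
  have h1 := ((contDiffOn_familyInChart hdev hf c₀).contDiffAt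
    ((ψ.open_target.prod hU).mem_nhds (x := (ψ c, t)) ⟨ψ.map_source hc, ht⟩)).differentiableAt
    (by simp)
  have h2 := h1.hasFDerivAt.comp_hasDerivAt t
    ((hasDerivAt_const t (ψ c)).prodMk (hasDerivAt_id' t))
  refine h2.congr_of_eventuallyEq (Filter.Eventually.of_forall fun s => ?_)
  simp only [Function.comp_apply, familyInChart, ψ.left_inv hc, ψ]

/-- The height coordinate separates the two directions: it grows at rate `1` in time and is constant
along each curve. The kernel is therefore confined to the curve directions, where the slices are
immersed and `dev` is an immersion. -/
theorem injective_fderiv_familyInChart (hdev : IsDevelopingMap dev) (hab : a < b) {U : Set ℝ}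
    (hU : IsOpen U) (habU : Icc a b ⊆ U)
    (hf : ContMDiffOn ((𝓡 1).prod 𝓘(ℝ, ℝ)) (𝓡 3) ∞ f (univ ×ˢ U))
    (hf_emb : ∀ t ∈ Icc a b, IsSmoothEmb (𝓡 1) (𝓡 3) (fun c => f (c, t)) ∧
      ∀ c, f (c, t) ∈ level dev t) (c₀ : C) {t₀ : ℝ} (ht₀ : t₀ ∈ Icc a b) :
    (∀ c ∈ (chartAt (EuclideanSpace ℝ (Fin 1)) c₀).source, ∀ t ∈ Icc a b,
      (fderiv ℝ (familyInChart dev f c₀) (chartAt (EuclideanSpace ℝ (Fin 1)) c₀ c, t) (0, 1)) 0 = 1) ∧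
    Function.Injective (fderiv ℝ (familyInChart dev f c₀)
      (chartAt (EuclideanSpace ℝ (Fin 1)) c₀ c₀, t₀)) := by
  set ψ := chartAt (EuclideanSpace ℝ (Fin 1)) c₀
  set F := familyInChart dev f c₀
  have hc₀ : c₀ ∈ ψ.source := mem_chart_source _ c₀
  -- The identity of height and time is known only on `[a, b]`. At the endpoints the two derivatives
  -- are compared as derivatives within this interval, where they are unique.
  have hone : ∀ c ∈ ψ.source, ∀ t ∈ Icc a b, (fderiv ℝ F (ψ c, t) (0, 1)) 0 = 1 := by
    intro c hc t ht
    have h1 := hasDerivAt_familyInChart hdev hU hf c₀ hc (habU ht)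
    have h2 : HasDerivWithinAt (fun s => dev (f (c, s)) 0) ((fderiv ℝ F (ψ c, t) (0, 1)) 0)
        (Icc a b) t :=
      ((EuclideanSpace.proj (𝕜 := ℝ) (0 : Fin 3)).hasFDerivAt.comp_hasDerivAt t
        h1).hasDerivWithinAt
    have h3 : HasDerivWithinAt (fun s => dev (f (c, s)) 0) 1 (Icc a b) t :=
      (hasDerivWithinAt_id t _).congr (fun s hs => (hf_emb s hs).2 c) ((hf_emb t ht).2 c)
    exact (uniqueDiffOn_Icc hab t ht).eq_deriv _ h2 h3
  refine ⟨hone, ?_⟩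
  have hψt : ψ c₀ ∈ ψ.target := ψ.map_source hc₀
  have hFd : HasFDerivAt F (fderiv ℝ F (ψ c₀, t₀)) (ψ c₀, t₀) :=
    (((contDiffOn_familyInChart hdev hf c₀).contDiffAt
      ((ψ.open_target.prod hU).mem_nhds (x := (ψ c₀, t₀)) ⟨hψt, habU ht₀⟩)).differentiableAt
      (by simp)).hasFDerivAt
  have hslice : HasFDerivAt (fun z => F (z, t₀)) ((fderiv ℝ F (ψ c₀, t₀)).comp
      (ContinuousLinearMap.inl ℝ _ ℝ)) (ψ c₀) :=
    HasFDerivAt.comp (f := fun z => (z, t₀)) (ψ c₀) hFd (hasFDerivAt_prodMk_left (ψ c₀) t₀)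
  have hzero : ∀ ζ, (fderiv ℝ F (ψ c₀, t₀) (ζ, 0)) 0 = 0 := by
    intro ζ
    have h1 : HasFDerivAt (fun z => F (z, t₀) 0)
        ((EuclideanSpace.proj (𝕜 := ℝ) (0 : Fin 3)).comp ((fderiv ℝ F (ψ c₀, t₀)).comp
          (ContinuousLinearMap.inl ℝ _ ℝ))) (ψ c₀) :=
      (EuclideanSpace.proj (𝕜 := ℝ) (0 : Fin 3)).hasFDerivAt.comp (ψ c₀) hslice
    have h2 : HasFDerivAt (fun z => F (z, t₀) 0) (0 : EuclideanSpace ℝ (Fin 1) →L[ℝ] ℝ) (ψ c₀) := by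
      have h3 : (fun z => F (z, t₀) 0) = fun _ => t₀ := funext fun z => (hf_emb t₀ ht₀).2 _
      rw [h3]
      exact hasFDerivAt_const _ _
    exact DFunLike.congr_fun (h1.unique h2) ζ
  have hinj : Function.Injective fun ζ => fderiv ℝ F (ψ c₀, t₀) (ζ, 0) := by
    have h1 : MDifferentiableAt (𝓡 1) (𝓡 1) ψ.symm (ψ c₀) :=
      mdifferentiableAt_atlas_symm (chart_mem_atlas _ c₀) hψt
    have hs : ψ.symm (ψ c₀) = c₀ := ψ.left_inv hc₀
    have h2 : MDifferentiableAt (𝓡 1) (𝓡 3) (fun c => f (c, t₀)) (ψ.symm (ψ c₀)) :=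
      (hf_emb t₀ ht₀).1.contMDiff.mdifferentiable (by simp) _
    have h3 : MDifferentiableAt (𝓡 3) (𝓡 3) dev (f (ψ.symm (ψ c₀), t₀)) :=
      hdev.contMDiff.mdifferentiable (by simp) _
    have h4 := mfderiv_comp (ψ c₀) h2 h1
    have h5 := mfderiv_comp (I := 𝓡 1) (I' := 𝓡 3) (I'' := 𝓡 3) (ψ c₀) (g := dev)
      (f := (fun c => f (c, t₀)) ∘ ψ.symm) h3 (h2.comp (ψ c₀) h1)
    have h6 : fderiv ℝ (fun z => F (z, t₀)) (ψ c₀) = mfderiv (𝓡 1) (𝓡 3)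
        (dev ∘ (fun c => f (c, t₀)) ∘ ψ.symm) (ψ c₀) := mfderiv_eq_fderiv.symm
    rw [hslice.fderiv, h5, h4] at h6
    have h7 : Function.Injective (mfderiv (𝓡 1) (𝓡 1) ψ.symm (ψ c₀)) :=
      (mdifferentiable_chart (I := 𝓡 1) c₀).symm.mfderiv_injective hψt
    have h8 := (hdev.mfderiv_injective (f (ψ.symm (ψ c₀), t₀))).comp
      (((hf_emb t₀ ht₀).1.injective_mfderiv (ψ.symm (ψ c₀))).comp h7)
    have h9 : (fun ζ => fderiv ℝ F (ψ c₀, t₀) (ζ, 0)) =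
        ⇑((fderiv ℝ F (ψ c₀, t₀)).comp (ContinuousLinearMap.inl ℝ _ ℝ)) := rfl
    rw [h9, h6]
    exact h8
  rw [injective_iff_map_eq_zero]
  rintro ⟨ζ, θ⟩ h0
  have h1 : fderiv ℝ F (ψ c₀, t₀) (ζ, θ) =
      fderiv ℝ F (ψ c₀, t₀) (ζ, 0) + θ • fderiv ℝ F (ψ c₀, t₀) (0, 1) := by
    rw [← map_smul, ← map_add]
    simp
  have hθ : θ = 0 := by
    have h2 := congrArg (fun v : EuclideanSpace ℝ (Fin 3) => v 0) (h1.symm.trans h0)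
    simpa [hzero ζ, hone c₀ hc₀ t₀ ht₀] using h2
  subst hθ
  have h3 : ζ = 0 := hinj (a₁ := ζ) (a₂ := 0) (by
    change fderiv ℝ F (ψ c₀, t₀) (ζ, 0) = fderiv ℝ F (ψ c₀, t₀) (0, 0)
    rw [h0, Prod.mk_zero_zero, map_zero])
  rw [h3]
  rfl

/-- The vertical unit vector. -/
noncomputable def vert : EuclideanSpace ℝ (Fin 3) := EuclideanSpace.single 0 1

theorem vert_zero : vert 0 = 1 := by simp [vert]

/-- A local left inverse of the developed family carries its time derivative to a field on an open
set of `ℝ³`, which pulls back along `dev`. Other pieces of the family may develop onto the same set,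
so their images in `M` are removed from the neighbourhood. -/
theorem exists_local_extension [T2Space M] [CompactSpace C] (hdev : IsDevelopingMap dev)
    (hab : a < b) {U : Set ℝ}
    (hU : IsOpen U) (habU : Icc a b ⊆ U)
    (hf : ContMDiffOn ((𝓡 1).prod 𝓘(ℝ, ℝ)) (𝓡 3) ∞ f (univ ×ˢ U))
    (hf_emb : ∀ t ∈ Icc a b, IsSmoothEmb (𝓡 1) (𝓡 3) (fun c => f (c, t)) ∧
      ∀ c, f (c, t) ∈ level dev t) (c₀ : C) {t₀ : ℝ} (ht₀ : t₀ ∈ Icc a b) :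
    ∃ O ∈ 𝓝 (f (c₀, t₀)), ∃ g : M → EuclideanSpace ℝ (Fin 3), ContMDiffOn (𝓡 3) (𝓡 3) ∞ g O ∧
      (∀ p, g p 0 = 1) ∧ ∀ c, ∀ t ∈ Icc a b, f (c, t) ∈ O →
        g (f (c, t)) = deriv (fun s => dev (f (c, s))) t := by
  set ψ := chartAt (EuclideanSpace ℝ (Fin 1)) c₀ with hψ
  set F := familyInChart dev f c₀ with hFdef
  have hc₀ : c₀ ∈ ψ.source := mem_chart_source _ c₀
  have hψt : ψ c₀ ∈ ψ.target := ψ.map_source hc₀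
  obtain ⟨hone, hinj⟩ := injective_fderiv_familyInChart hdev hab hU habU hf hf_emb c₀ ht₀
  have hFs := contDiffOn_familyInChart hdev hf c₀
  have hO : IsOpen (ψ.target ×ˢ U) := ψ.open_target.prod hU
  obtain ⟨W, hW, hzW, H, hH, hHm, hHF⟩ := exists_smooth_left_inverse hO
    (z := (ψ c₀, t₀)) ⟨hψt, habU ht₀⟩ hFs hinj
  have hFf : ∀ c ∈ ψ.source, ∀ t, F (ψ c, t) = dev (f (c, t)) := by
    intro c hc t
    simp only [hFdef, familyInChart, ← hψ, ψ.left_inv hc]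
  let X : EuclideanSpace ℝ (Fin 3) → EuclideanSpace ℝ (Fin 3) := fun y => fderiv ℝ F (H y) (0, 1)
  have hX : ContDiffOn ℝ ∞ X W := by
    have h1 : ContDiffOn ℝ ∞ (fderiv ℝ F) (ψ.target ×ˢ U) := hFs.fderiv_of_isOpen hO (by simp)
    exact (h1.comp hH hHm).clm_apply contDiffOn_const
  -- The vertical correction forces height component `1` everywhere. It vanishes on the nearby part
  -- of the family, where the time derivative already has that component.
  let g : M → EuclideanSpace ℝ (Fin 3) := fun p => X (dev p) + (1 - X (dev p) 0) • vert
  have hY : ContDiffOn ℝ ∞ (fun y => X y + (1 - X y 0) • vert) W := by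
    have h1 : ContDiffOn ℝ ∞ (fun y => X y 0) W :=
      (EuclideanSpace.proj (𝕜 := ℝ) (0 : Fin 3)).contDiff.comp_contDiffOn hX
    exact hX.add ((contDiffOn_const.sub h1).smul contDiffOn_const)
  have hg : ContMDiffOn (𝓡 3) (𝓡 3) ∞ g (dev ⁻¹' W) :=
    hY.contMDiffOn.comp hdev.contMDiff.contMDiffOn (fun p hp => hp)
  obtain ⟨N, hN, hNo, hzN⟩ := eventually_nhds_iff.1 hHF
  -- the part of the compact family outside a neighbourhood of `(c₀, t₀)`
  let S : Set (C × ℝ) := {z | z.1 ∈ ψ.source ∧ (ψ z.1, z.2) ∈ N}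
  have hS : S ∈ 𝓝 (c₀, t₀) := by
    have h1 : ContinuousAt (fun z : C × ℝ => (ψ z.1, z.2)) (c₀, t₀) :=
      ((ψ.continuousAt hc₀).comp (x := (c₀, t₀)) continuousAt_fst).prodMk continuousAt_snd
    exact Filter.inter_mem (continuousAt_fst.preimage_mem_nhds (ψ.open_source.mem_nhds hc₀))
      (h1.preimage_mem_nhds (hNo.mem_nhds hzN))
  let K : Set (C × ℝ) := (univ ×ˢ Icc a b) \ interior S
  have hK : IsCompact K := (isCompact_univ.prod isCompact_Icc).diff isOpen_interior
  have hfK : IsClosed (f '' K) := (hK.image_of_continuousOn (hf.continuousOn.mono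
    (sdiff_subset.trans (prod_mono_right habU)))).isClosed
  -- The height determines the time and each slice is injective, so the band meets `f (c₀, t₀)` only
  -- at `(c₀, t₀)` itself.
  have hp₀ : f (c₀, t₀) ∉ f '' K := by
    rintro ⟨⟨c, t⟩, ⟨⟨-, ht⟩, hS'⟩, heq⟩
    have h1 : t = t₀ := by
      rw [← (hf_emb t ht).2 c, ← (hf_emb t₀ ht₀).2 c₀, heq]
    subst h1
    have h2 : c = c₀ := (hf_emb t ht).1.isEmbedding.injective heq
    subst h2
    exact hS' (mem_interior_iff_mem_nhds.2 hS)
  refine ⟨dev ⁻¹' W ∩ (f '' K)ᶜ, Filter.inter_mem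
    ((hW.preimage hdev.continuous).mem_nhds ?_) (hfK.isOpen_compl.mem_nhds hp₀), g,
    hg.mono inter_subset_left, fun p => ?_, ?_⟩
  · rw [mem_preimage, ← hFf c₀ hc₀]
    exact hzW
  · simp [g, vert_zero]
  · rintro c t ht ⟨-, hct⟩
    have h1 : (c, t) ∈ S := by
      by_contra h2
      exact hct ⟨(c, t), ⟨⟨mem_univ _, ht⟩, fun h3 => h2 (interior_subset h3)⟩, rfl⟩
    have h2 : H (dev (f (c, t))) = (ψ c, t) := by
      rw [← hFf c h1.1]
      exact hN _ h1.2
    rw [(hasDerivAt_familyInChart hdev hU hf c₀ h1.1 (habU ht)).deriv]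
    have h3 : X (dev (f (c, t))) = fderiv ℝ F (ψ c, t) (0, 1) := by simp only [X, h2]
    have h4 : (fderiv ℝ F (ψ c, t) (0, 1)) 0 = 1 := hone c h1.1 t ht
    simp only [g, h3, h4, sub_self, zero_smul, add_zero]
    rfl

/-- A vector field with vertical speed `1`, extending the velocity of the family of curves `f`
and vertical off a compact set. -/
theorem exists_extension_field [T2Space M] [SecondCountableTopology M] [CompactSpace C]
    (hdev : IsDevelopingMap dev) (hab : a < b) (hf : IsSmoothOnBand (𝓡 1) (𝓡 3) a b f)
    (hf_emb : ∀ t ∈ Icc a b, IsSmoothEmb (𝓡 1) (𝓡 3) (fun c => f (c, t)) ∧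
      ∀ c, f (c, t) ∈ level dev t) :
    ∃ V : M → EuclideanSpace ℝ (Fin 3), ContMDiff (𝓡 3) (𝓡 3) ∞ V ∧ (∀ p, V p 0 = 1) ∧
      (∀ c, ∀ t ∈ Icc a b, HasDerivAt (fun s => dev (f (c, s))) (V (f (c, t))) t) ∧
      (∀ c, ContinuousOn (fun s => f (c, s)) (Icc a b)) ∧
      ∃ N : Set M, IsCompact N ∧ (∀ c, ∀ t ∈ Icc a b, f (c, t) ∈ N) ∧ ∀ p ∉ N, V p = vert := by
  obtain ⟨U, hU, habU, hf⟩ := hf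
  have := isManifold_of_affine (n := 3) (M := M)
  have : LocallyCompactSpace M := Manifold.locallyCompact_of_finiteDimensional (𝓡 3)
  let K := f '' (univ ×ˢ Icc a b)
  have hK : IsCompact K := (isCompact_univ.prod isCompact_Icc).image_of_continuousOn
    (hf.continuousOn.mono (prod_mono_right habU))
  obtain ⟨N, hN, hKN⟩ := exists_compact_superset hK
  have hfK : ∀ c, ∀ t ∈ Icc a b, f (c, t) ∈ K := fun c t ht => ⟨_, ⟨mem_univ _, ht⟩, rfl⟩
  -- All the requirements are affine conditions on the value at `p`, so a partition of unity can
  -- average the local solutions.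
  let T : M → Set (EuclideanSpace ℝ (Fin 3)) := fun p => {y | y 0 = 1 ∧
    (∀ c, ∀ t ∈ Icc a b, f (c, t) = p → y = deriv (fun s => dev (f (c, s))) t) ∧
    (p ∉ N → y = vert)}
  have hT : ∀ p, Convex ℝ (T p) := by
    rintro p y ⟨hy1, hy2, hy3⟩ z ⟨hz1, hz2, hz3⟩ α β hα hβ hαβ
    refine ⟨?_, fun c t ht h => ?_, fun h => ?_⟩
    · simp [hy1, hz1, hαβ]
    · rw [hy2 c t ht h, hz2 c t ht h, ← add_smul, hαβ, one_smul]
    · rw [hy3 h, hz3 h, ← add_smul, hαβ, one_smul]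
  have hloc : ∀ p : M, ∃ O ∈ 𝓝 p, ∃ g : M → EuclideanSpace ℝ (Fin 3),
      ContMDiffOn (𝓡 3) (𝓡 3) ∞ g O ∧ ∀ y ∈ O, g y ∈ T y := by
    intro p
    by_cases hp : p ∈ K
    · obtain ⟨⟨c₀, t₀⟩, ⟨-, ht₀⟩, rfl⟩ := hp
      obtain ⟨O, hO, g, hg, hg1, hg2⟩ :=
        exists_local_extension hdev hab hU habU hf hf_emb c₀ ht₀
      refine ⟨O ∩ interior N, Filter.inter_mem hO (isOpen_interior.mem_nhds
        (hKN (hfK c₀ t₀ ht₀))), g, hg.mono inter_subset_left, fun y hy => ⟨hg1 y, ?_, ?_⟩⟩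
      · rintro c t ht rfl
        exact hg2 c t ht hy.1
      · exact fun h => absurd (interior_subset hy.2) h
    · refine ⟨Kᶜ, hK.isClosed.isOpen_compl.mem_nhds hp, fun _ => vert, contMDiffOn_const,
        fun y hy => ⟨vert_zero, ?_, fun _ => rfl⟩⟩
      rintro c t ht rfl
      exact absurd (hfK c t ht) hy
  obtain ⟨V, hV⟩ := exists_contMDiffMap_forall_mem_convex_of_local (𝓡 3) (n := ⊤) hT hloc
  refine ⟨V, V.contMDiff, fun p => (hV p).1, fun c t ht => ?_, fun c t ht => ?_, N, hN,
    fun c t ht => interior_subset (hKN (hfK c t ht)), fun p hp => (hV p).2.2 hp⟩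
  · rw [(hV (f (c, t))).2.1 c t ht rfl]
    exact (hasDerivAt_familyInChart hdev hU hf c (mem_chart_source _ c)
      (habU ht)).differentiableAt.hasDerivAt
  · exact (hf.continuousOn.continuousAt ((isOpen_univ.prod hU).mem_nhds
      ⟨mem_univ _, habU ht⟩)).comp_continuousWithinAt (f := fun s => (c, s))
        (by fun_prop)

end Extension

end Drum

/-! ## The metric of the developing map -/

namespace Drum

section Metric

variable {n : ℕ} {M : Type*} [TopologicalSpace M] [ChartedSpace (EuclideanSpace ℝ (Fin n)) M]
  [HasGroupoid M (affineGroupoid n)] {dev : M → EuclideanSpace ℝ (Fin n)}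

/-- Lifts of segments are no longer than the segments. -/
theorem devEDist_le_of_lift (hdev : IsDevelopingMap dev) {c : ℝ → M}
    (hc : ContinuousOn c (Icc 0 1)) {y v : EuclideanSpace ℝ (Fin n)}
    (hcv : ∀ t ∈ Icc (0 : ℝ) 1, dev (c t) = y + t • v) : devEDist dev (c 0) (c 1) ≤ ‖v‖ₑ := by
  have hcs : ContMDiffOn 𝓘(ℝ, ℝ) (𝓡 n) 1 c (Icc 0 1) := by
    intro t ht
    obtain ⟨h, hq, hh, hsm⟩ := hdev.exists_chart (c t)
    have h1 : y + t • v ∈ h.target := by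
      rw [← hcv t ht, ← hh]
      exact h.map_source hq
    have h2 : ContMDiffAt (𝓡 n) (𝓡 n) ∞ h.symm (y + t • v) :=
      hsm.contMDiffAt (h.open_target.mem_nhds h1)
    have h3 : ContMDiff 𝓘(ℝ, ℝ) (𝓡 n) ∞ (fun t : ℝ => y + t • v) :=
      (contDiff_const.add (contDiff_id.smul contDiff_const)).contMDiff
    have h4 : ContMDiffAt 𝓘(ℝ, ℝ) (𝓡 n) 1 (fun t : ℝ => h.symm (y + t • v)) t :=
      (ContMDiffAt.comp t h2 h3.contMDiffAt).of_le (by simp)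
    have h5 : ∀ s ∈ Icc (0 : ℝ) 1, c s ∈ h.source → c s = h.symm (y + s • v) := by
      intro s hs hs'
      rw [← hcv s hs, ← hh, h.left_inv hs']
    refine h4.contMDiffWithinAt.congr_of_eventuallyEq ?_ (h5 t ht hq)
    filter_upwards [self_mem_nhdsWithin, (hc t ht).eventually (h.open_source.mem_nhds hq)]
      with s hs hs'
    exact h5 s hs hs'
  rw [devEDist]
  let := devENorm dev
  have := devENorm_smul dev
  refine (Manifold.riemannianEDist_le_pathELength hcs rfl rfl zero_le_one).trans ?_
  rw [Manifold.pathELength_eq_lintegral_mfderivWithin_Icc]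
  have key : ∀ t ∈ Icc (0 : ℝ) 1,
      ‖mfderivWithin 𝓘(ℝ, ℝ) (𝓡 n) c (Icc (0 : ℝ) 1) t (1 : ℝ)‖ₑ = ‖v‖ₑ := by
    intro t ht
    have hd : MDifferentiableAt (𝓡 n) (𝓡 n) dev (c t) := hdev.contMDiff.mdifferentiableAt (by simp)
    have h1 := mfderivWithin_comp t (I := 𝓘(ℝ, ℝ)) (I' := 𝓡 n) (I'' := 𝓡 n) (g := dev) (f := c)
      (s := Icc (0 : ℝ) 1) (u := univ) hd.mdifferentiableWithinAt
      (hcs.mdifferentiableOn one_ne_zero t ht) (by simp)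
      (uniqueMDiffWithinAt_iff_uniqueDiffWithinAt.2 (uniqueDiffOn_Icc zero_lt_one t ht))
    have h2 : derivWithin (dev ∘ c) (Icc 0 1) t =
        (mfderivWithin 𝓘(ℝ, ℝ) (𝓡 n) (dev ∘ c) (Icc (0 : ℝ) 1) t) (1 : ℝ) := by
      rw [mfderivWithin_eq_fderivWithin]; rfl
    have h3 : HasDerivWithinAt (dev ∘ c) v (Icc 0 1) t := by
      have h4 : HasDerivAt (fun t : ℝ => y + t • v) ((1 : ℝ) • v) t :=
        ((hasDerivAt_id' t).smul_const v).const_add y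
      rw [one_smul] at h4
      exact h4.hasDerivWithinAt.congr hcv (hcv t ht)
    rw [h1, mfderivWithin_univ, h3.derivWithin (uniqueDiffOn_Icc zero_lt_one t ht)] at h2
    change enorm (E := EuclideanSpace ℝ (Fin n)) _ = _
    rw [h2]
    rfl
  refine (le_of_eq (MeasureTheory.setLIntegral_congr_fun measurableSet_Icc key)).trans ?_
  simp

/-- `devEDist`-balls around a point of `M` are eventually contained in a developing chart. -/
theorem exists_devEDist_ball_subset [T2Space M] (hdev : IsDevelopingMap dev) (m : M)
    (h : OpenPartialHomeomorph M (EuclideanSpace ℝ (Fin n))) (hm : m ∈ h.source)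
    (hh : ∀ p, h p = dev p) :
    ∃ r : ℝ≥0∞, 0 < r ∧ ∀ y, devEDist dev m y < r → y ∈ h.source := by
  have hm' : dev m ∈ h.target := hh m ▸ h.map_source hm
  obtain ⟨r, hr, hrt⟩ := EMetric.isOpen_iff.1 h.open_target _ hm'
  refine ⟨r, hr, fun y hy => ?_⟩
  have hlen := edist_dev_le hdev
  rw [devEDist] at hy
  simp only [devEDist] at hlen
  let := devENorm dev
  have := devENorm_smul dev
  obtain ⟨γ, h0, h1, hγ, hl⟩ := Manifold.exists_lt_of_riemannianEDist_lt hy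
  have hball : ∀ t ∈ Icc (0 : ℝ) 1, dev (γ t) ∈ h.target := by
    intro t ht
    refine hrt ?_
    rw [Metric.mem_eball, edist_comm]
    calc edist (dev m) (dev (γ t)) ≤ Manifold.riemannianEDist (𝓡 n) m (γ t) := hlen _ _
      _ ≤ Manifold.pathELength (𝓡 n) γ 0 t :=
        Manifold.riemannianEDist_le_pathELength (hγ.mono (Icc_subset_Icc_right ht.2)) h0 rfl ht.1
      _ ≤ Manifold.pathELength (𝓡 n) γ 0 1 := Manifold.pathELength_mono le_rfl ht.2
      _ < r := hl
  rw [← h1]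
  -- A short path develops into the target of the chart, and it remains in the source: leaving is
  -- impossible since being equal to `h.symm ∘ dev ∘ γ` is a closed condition in a Hausdorff space.
  refine (isPreconnected_Icc.induction₂ (fun s t => γ s ∈ h.source ↔ γ t ∈ h.source) ?_
    (fun x y z _ _ _ h1 h2 => h1.trans h2) (fun x y _ _ h => h.symm)
    (left_mem_Icc.2 (zero_le_one' ℝ)) (right_mem_Icc.2 (zero_le_one' ℝ))).1 (h0 ▸ hm)
  intro t ht
  have hγt := hγ.continuousOn t ht
  by_cases hs : γ t ∈ h.source
  · filter_upwards [hγt.eventually (h.open_source.mem_nhds hs)] with s hs'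
    exact iff_of_true hs hs'
  · have hne : γ t ≠ h.symm (dev (γ t)) := fun heq =>
      hs (heq ▸ h.map_target (hball t ht))
    have h2 : ContinuousWithinAt (fun s => h.symm (dev (γ s))) (Icc 0 1) t :=
      ((h.continuousAt_symm (hball t ht)).comp hdev.continuous.continuousAt).comp_continuousWithinAt
        hγt
    filter_upwards [(hγt.prodMk h2).tendsto.eventually
      (isClosed_diagonal.isOpen_compl.mem_nhds hne)] with s hs'
    refine iff_of_false hs fun h3 => hs' ?_
    rw [mem_diagonal_iff]
    change γ s = h.symm (dev (γ s))
    rw [← hh, h.left_inv h3]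

/-- Near `p` the chart inverse lifts the straight segment from `dev x` to `dev p`, so the path
distance is bounded by the Euclidean one. -/
theorem continuous_toDevSpace (hdev : IsDevelopingMap dev) :
    @Continuous M (DevSpace dev) _ _ id := by
  refine continuous_iff_continuousAt.2 fun p => ?_
  obtain ⟨h, hq, hh, -⟩ := hdev.exists_chart p
  have hp' : dev p ∈ h.target := hh p ▸ h.map_source hq
  obtain ⟨r, hr, hrt⟩ := Metric.isOpen_iff.1 h.open_target _ hp'
  refine (EMetric.tendsto_nhds (α := DevSpace dev)).2 fun ε hε => ?_
  have h1 : ∀ᶠ x in 𝓝 p, dev x ∈ Metric.ball (dev p) r ∧ edist (dev x) (dev p) < ε :=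
    hdev.continuous.continuousAt.eventually (Filter.Eventually.and (Metric.ball_mem_nhds _ hr)
      (Metric.eball_mem_nhds _ hε))
  filter_upwards [h.open_source.mem_nhds hq, h1] with x hx hx1
  have hseg : ∀ t ∈ Icc (0 : ℝ) 1, dev x + t • (dev p - dev x) ∈ h.target := fun t ht =>
    hrt ((convex_ball _ _).add_smul_sub_mem hx1.1 (Metric.mem_ball_self hr) ht)
  have h2 := devEDist_le_of_lift hdev (c := fun t => h.symm (dev x + t • (dev p - dev x)))
    (h.continuousOn_symm.comp (by fun_prop) hseg)
    (fun t ht => by rw [← hh, h.right_inv (hseg t ht)])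
  simp only [zero_smul, add_zero, one_smul, add_sub_cancel] at h2
  rw [← hh x, ← hh p, h.left_inv hx, h.left_inv hq] at h2
  refine lt_of_le_of_lt h2 ?_
  rw [← edist_eq_enorm_sub, hh, hh, edist_comm]
  exact hx1.2

end Metric

/-! ## Filling in a boundary point of a half ball -/

section HalfBall

/-- The vertices of a small simplex below the plane `ℓ = ℓ z`, with `z` in the relative interior of
its face in the plane. -/
noncomputable def halfBallVertices (ℓ : EuclideanSpace ℝ (Fin 3) →L[ℝ] ℝ)
    (z u : EuclideanSpace ℝ (Fin 3)) (δ : ℝ) : Fin 4 → EuclideanSpace ℝ (Fin 3) :=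
  let a₁ := EuclideanSpace.single 1 1 - ℓ (EuclideanSpace.single 1 1) • u
  let a₂ := EuclideanSpace.single 2 1 - ℓ (EuclideanSpace.single 2 1) • u
  ![z - δ • u, z + δ • a₁, z + δ • a₂, z - δ • (a₁ + a₂)]

variable {ℓ : EuclideanSpace ℝ (Fin 3) →L[ℝ] ℝ} {z u : EuclideanSpace ℝ (Fin 3)} {σ : ℝ}

/-- Since `u` is vertical, coordinates `1` and `2` separate the vertices of the top face, while `ℓ`
separates the bottom vertex from that face. -/
theorem affineIndependent_halfBallVertices (hu : u = σ • vert) (hℓu : ℓ u = 1) {δ : ℝ}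
    (hδ : 0 < δ) : AffineIndependent ℝ (halfBallVertices ℓ z u δ) := by
  rw [affineIndependent_iff_of_fintype]
  intro w hw hw'
  rw [Finset.weightedVSub_eq_linear_combination _ hw] at hw'
  have hu1 : u 1 = 0 := by simp [hu, vert]
  have hu2 : u 2 = 0 := by simp [hu, vert]
  have h1 := congrArg (fun v : EuclideanSpace ℝ (Fin 3) => v 1) hw'
  have h2 := congrArg (fun v : EuclideanSpace ℝ (Fin 3) => v 2) hw'
  have h0 := congrArg ℓ hw'
  simp [Fin.sum_univ_four, halfBallVertices, hu1, hu2, hℓu] at h0 h1 h2 hw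
  have e0 : w 0 * δ = 0 := by linear_combination (-1) * h0 + ℓ z * hw
  have w0 : w 0 = 0 := by
    rcases mul_eq_zero.1 e0 with h | h
    · exact h
    · exact absurd h hδ.ne'
  have e1 : (w 1 - w 3) * δ = 0 := by linear_combination h1 - z 1 * hw
  have e2 : (w 2 - w 3) * δ = 0 := by linear_combination h2 - z 2 * hw
  have w1 : w 1 = w 3 := by
    rcases mul_eq_zero.1 e1 with h | h
    · linarith
    · exact absurd h hδ.ne'
  have w2 : w 2 = w 3 := by
    rcases mul_eq_zero.1 e2 with h | h
    · linarith
    · exact absurd h hδ.ne'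
  have w3 : w 3 = 0 := by linarith
  intro i
  fin_cases i
  · exact w0
  · exact w1.trans w3
  · exact w2.trans w3
  · exact w3

theorem halfBallVertices_le (hℓu : ℓ u = 1) {δ : ℝ} (hδ : 0 < δ) (i : Fin 4) :
    ℓ (halfBallVertices ℓ z u δ i) ≤ ℓ z := by
  fin_cases i <;> simp [halfBallVertices, hℓu, hδ.le]

theorem tendsto_halfBallVertices (i : Fin 4) :
    Filter.Tendsto (fun δ => halfBallVertices ℓ z u δ i) (𝓝 0) (𝓝 z) := by
  have h1 : ∀ v : EuclideanSpace ℝ (Fin 3), Filter.Tendsto (fun δ : ℝ => z + δ • v) (𝓝 0) (𝓝 z) := by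
    intro v
    have : Continuous fun δ : ℝ => z + δ • v := by fun_prop
    simpa using this.tendsto 0
  have h2 : ∀ v : EuclideanSpace ℝ (Fin 3), Filter.Tendsto (fun δ : ℝ => z - δ • v) (𝓝 0) (𝓝 z) := by
    intro v
    have : Continuous fun δ : ℝ => z - δ • v := by fun_prop
    simpa using this.tendsto 0
  fin_cases i
  · exact h2 _
  · exact h1 _
  · exact h1 _
  · exact h2 _

theorem affineCombination_halfBallVertices (δ : ℝ) :
    Finset.univ.affineCombination ℝ (halfBallVertices ℓ z u δ) ![0, 1 / 3, 1 / 3, 1 / 3] = z := by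
  rw [Finset.affineCombination_eq_linear_combination]
  · simp only [Fin.sum_univ_four, halfBallVertices, Matrix.cons_val_zero, Matrix.cons_val_one,
      Matrix.cons_val]
    module
  · simp [Fin.sum_univ_four]
    norm_num

variable {M : Type*} [TopologicalSpace M] [ChartedSpace (EuclideanSpace ℝ (Fin 3)) M]
  [HasGroupoid M (affineGroupoid 3)] [T2Space M] {dev : M → EuclideanSpace ℝ (Fin 3)}

/-- In a `2`-convex manifold, a section of the developing map over a punctured half ball around `z`
extends to `z`. -/
theorem exists_chart_of_halfBall (hdev : IsDevelopingMap dev) (hconv : IsMConvex 2 dev)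
    (hu : u = σ • vert) (hℓu : ℓ u = 1) {O : Set (EuclideanSpace ℝ (Fin 3))} (hO : O ∈ 𝓝 z)
    {g : EuclideanSpace ℝ (Fin 3) → M}
    (hg : ContinuousOn g {y | y ∈ O ∧ ℓ y ≤ ℓ z ∧ y ≠ z})
    (hdg : ∀ y ∈ O, ℓ y ≤ ℓ z → y ≠ z → dev (g y) = y) :
    ∃ h : OpenPartialHomeomorph M (EuclideanSpace ℝ (Fin 3)), (∀ p, h p = dev p) ∧ z ∈ h.target ∧
      ∀ᶠ t in 𝓝[>] (0 : ℝ), g (z - t • u) ∈ h.source := by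
  classical
  -- the simplex
  obtain ⟨ε, hε, hεO⟩ := Metric.mem_nhds_iff.1 hO
  obtain ⟨δ, hδε, hδ⟩ : ∃ δ : ℝ, (∀ i, halfBallVertices ℓ z u δ i ∈ Metric.ball z ε) ∧ 0 < δ := by
    have h1 : ∀ᶠ δ in 𝓝 (0 : ℝ), ∀ i, halfBallVertices ℓ z u δ i ∈ Metric.ball z ε :=
      Filter.eventually_all.2 fun i =>
        (tendsto_halfBallVertices i).eventually (Metric.ball_mem_nhds z hε)
    exact ((h1.filter_mono nhdsWithin_le_nhds).and (self_mem_nhdsWithin (s := Ioi 0))).exists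
  let s : Affine.Simplex ℝ (EuclideanSpace ℝ (Fin 3)) 3 :=
    ⟨halfBallVertices ℓ z u δ, affineIndependent_halfBallVertices hu hℓu hδ⟩
  let T := s.closedInterior
  have hThull : convexHull ℝ (range s.points) = T := Affine.Simplex.convexHull_eq_closedInterior s
  have hTconv : Convex ℝ T := hThull ▸ convex_convexHull ℝ _
  have hTball : T ⊆ Metric.ball z ε := by
    rw [← hThull]
    exact convexHull_min (range_subset_iff.2 hδε) (convex_ball _ _)
  have hTℓ : ∀ y ∈ T, ℓ y ≤ ℓ z := by
    rw [← hThull]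
    have h2 : Convex ℝ {y | ℓ y ≤ ℓ z} := convex_halfSpace_le ℓ.toLinearMap.isLinear _
    exact convexHull_min (range_subset_iff.2 fun i => halfBallVertices_le hℓu hδ i) h2
  have hw1 : ∑ i, (![0, 1 / 3, 1 / 3, 1 / 3] : Fin 4 → ℝ) i = 1 := by
    simp [Fin.sum_univ_four]
    norm_num
  -- Barycentric coordinates locate `z`: only the coordinate of the bottom vertex `0` vanishes, so
  -- `z` lies on the opposite face and on no other.
  have hz : z = Finset.univ.affineCombination ℝ s.points ![0, 1 / 3, 1 / 3, 1 / 3] :=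
    (affineCombination_halfBallVertices δ).symm
  have hzT : z ∈ T := by
    rw [hz]
    refine (Affine.Simplex.affineCombination_mem_closedInterior_iff hw1).2 fun i => ?_
    fin_cases i <;> norm_num
  have hzint : z ∉ s.interior := by
    rw [hz, Affine.Simplex.affineCombination_mem_interior_iff hw1]
    exact fun h => absurd (h 0).1 (by simp)
  have hzface : ∀ j : Fin 4, j ≠ 0 → z ∉ (s.faceOpposite j).closedInterior := by
    intro j hj
    rw [hz, Affine.Simplex.faceOpposite,
      Affine.Simplex.affineCombination_mem_closedInterior_face_iff_mem_Icc _ _ hw1]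
    rintro ⟨-, h⟩
    have := h j (by simp)
    fin_cases j
    · exact hj rfl
    all_goals norm_num at this
  have hv0 : z - δ • u ∈ T := s.point_mem_closedInterior 0
  have hzt : ∀ t ∈ Icc 0 δ, z - t • u ∈ T := by
    intro t ht
    have h1 := hTconv.add_smul_sub_mem hzT hv0 (t := t / δ)
      ⟨div_nonneg ht.1 hδ.le, (div_le_one hδ).2 ht.2⟩
    have h2 : z + (t / δ) • (z - δ • u - z) = z - t • u := by
      rw [sub_sub_cancel_left, smul_neg, smul_smul, div_mul_cancel₀ _ hδ.ne', sub_eq_add_neg]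
    rwa [h2] at h1
  -- the section over the punctured simplex
  have hcont : ContinuousOn g (T \ {z}) := hg.mono fun y hy => ⟨hεO (hTball hy.1), hTℓ y hy.1, hy.2⟩
  have hdgT : ∀ y ∈ T, y ≠ z → dev (g y) = y := fun y hy hyz =>
    hdg y (hεO (hTball hy)) (hTℓ y hy) hyz
  -- A segment with one end strictly below the plane and the other different from `z` misses `z`, so
  -- the section lifts it.
  have hlip : ∀ y ∈ T, y ≠ z → ∀ y' ∈ T, ℓ y' < ℓ z → devEDist dev (g y) (g y') ≤ edist y y' := by
    intro y hy hyz y' hy' hℓ'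
    have hseg : ∀ t ∈ Icc (0 : ℝ) 1, y + t • (y' - y) ∈ T \ {z} := by
      intro t ht
      refine ⟨hTconv.add_smul_sub_mem hy hy' ht, fun heq => ?_⟩
      rcases ht.1.eq_or_lt with rfl | ht0
      · rw [zero_smul, add_zero] at heq
        exact hyz heq
      · have h1 := congrArg ℓ (show y + t • (y' - y) = z from heq)
        rw [map_add, map_smul, map_sub, smul_eq_mul] at h1
        nlinarith [hTℓ y hy, ht.2, mul_pos ht0 (sub_pos.2 hℓ'),
          mul_nonneg (sub_nonneg.2 ht.2) (sub_nonneg.2 (hTℓ y hy))]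
    have h2 := devEDist_le_of_lift hdev (c := fun t => g (y + t • (y' - y)))
      (hcont.comp (by fun_prop) hseg) (fun t ht => hdgT _ (hseg t ht).1 (hseg t ht).2)
    simp only [zero_smul, add_zero, one_smul, add_sub_cancel] at h2
    rwa [← edist_eq_enorm_sub, edist_comm] at h2
  -- Two points are joined through `z - t • u`, just below `z`, and `t` tends to `0`. This bounds
  -- the path distance by a quantity that is small near `z`.
  have hcauchy : ∀ y ∈ T \ {z}, ∀ y' ∈ T \ {z},
      devEDist dev (g y) (g y') ≤ edist y z + edist z y' := by
    intro y hy y' hy'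
    have htend : Filter.Tendsto (fun t : ℝ => edist y (z - t • u) + edist (z - t • u) y') (𝓝[>] 0)
        (𝓝 (edist y z + edist z y')) := by
      have h1 : Continuous fun t : ℝ => edist y (z - t • u) + edist (z - t • u) y' := by fun_prop
      have h2 := h1.tendsto 0
      simp only [zero_smul, sub_zero] at h2
      exact h2.mono_left nhdsWithin_le_nhds
    refine ge_of_tendsto htend ?_
    filter_upwards [Ioc_mem_nhdsGT hδ] with t ht
    have h3 : z - t • u ∈ T := hzt t ⟨ht.1.le, ht.2⟩
    have h4 : ℓ (z - t • u) < ℓ z := by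
      rw [map_sub, map_smul, hℓu, smul_eq_mul, mul_one]
      linarith [ht.1]
    refine (edist_triangle (α := DevSpace dev) _ (g (z - t • u)) _).trans (add_le_add ?_ ?_)
    · exact hlip y hy.1 hy.2 _ h3 h4
    · refine (edist_comm (α := DevSpace dev) _ _).trans_le ?_
      rw [edist_comm (z - t • u)]
      exact hlip y' hy'.1 hy'.2 _ h3 h4
  -- the limit at `z` in the completion
  let G : EuclideanSpace ℝ (Fin 3) → DevSpace dev := g
  have hGc : ContinuousOn G (T \ {z}) := (continuous_toDevSpace hdev).comp_continuousOn hcont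
  have htz : ∀ᶠ t in 𝓝[>] (0 : ℝ), z - t • u ∈ T \ {z} := by
    filter_upwards [Ioc_mem_nhdsGT hδ] with t ht
    refine ⟨hzt t ⟨ht.1.le, ht.2⟩, fun heq => ?_⟩
    have h1 := congrArg ℓ (show z - t • u = z from heq)
    rw [map_sub, map_smul, hℓu, smul_eq_mul, mul_one] at h1
    linarith [ht.1]
  have htend : Filter.Tendsto (fun t : ℝ => z - t • u) (𝓝[>] 0) (𝓝[T \ {z}] z) := by
    refine tendsto_nhdsWithin_iff.2 ⟨?_, htz⟩
    have h1 : Continuous fun t : ℝ => z - t • u := by fun_prop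
    have h2 := h1.tendsto 0
    simp only [zero_smul, sub_zero] at h2
    exact h2.mono_left nhdsWithin_le_nhds
  have hne : (𝓝[T \ {z}] z).NeBot := htend.neBot
  have hcauchyG : Cauchy (Filter.map G (𝓝[T \ {z}] z)) := by
    refine EMetric.cauchy_iff.2 ⟨(hne.map G).ne, fun ε hε => ?_⟩
    refine ⟨G '' ((T \ {z}) ∩ Metric.eball z (ε / 2)), Filter.image_mem_map
      (inter_mem_nhdsWithin _ (Metric.eball_mem_nhds _ (ENNReal.half_pos hε.ne'))), ?_⟩
    rintro _ ⟨y, ⟨hy, hyε⟩, rfl⟩ _ ⟨y', ⟨hy', hyε'⟩, rfl⟩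
    refine (hcauchy y hy y' hy').trans_lt ?_
    rw [Metric.mem_eball] at hyε hyε'
    rw [edist_comm z]
    exact (ENNReal.add_lt_add hyε hyε').trans_eq (ENNReal.add_halves ε)
  obtain ⟨ξ, hξ⟩ := CompleteSpace.complete
    (hcauchyG.map (UniformSpace.Completion.uniformContinuous_coe (DevSpace dev)))
  rw [Filter.map_map] at hξ
  -- the simplex in the completion
  let sec : EuclideanSpace ℝ (Fin 3) → DevCompletion dev :=
    Function.update (fun y => ((G y : DevSpace dev) : DevCompletion dev)) z ξ
  have hsecz : sec z = ξ := Function.update_self _ _ _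
  have hsec : ∀ y, y ≠ z → sec y = ((G y : DevSpace dev) : DevCompletion dev) := fun y hy =>
    Function.update_of_ne hy _ _
  have hsecc : ContinuousOn sec T := by
    rw [continuousOn_update_iff]
    exact ⟨(UniformSpace.Completion.continuous_coe _).comp_continuousOn hGc, fun _ => hξ⟩
  have hext : Continuous (devExt dev) := UniformSpace.Completion.continuous_extension
  have hext_sec : ∀ y ∈ T, devExt dev (sec y) = y := by
    intro y hy
    by_cases hyz : y = z
    · subst hyz
      rw [hsecz]
      have h1 : Filter.Tendsto (fun y => devExt dev ((G y : DevSpace dev) : DevCompletion dev))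
          (𝓝[T \ {y}] y) (𝓝 (devExt dev ξ)) := (hext.tendsto ξ).comp hξ
      have h2 : Filter.Tendsto (fun y => devExt dev ((G y : DevSpace dev) : DevCompletion dev))
          (𝓝[T \ {y}] y) (𝓝 y) := by
        refine (Filter.tendsto_id.mono_left nhdsWithin_le_nhds).congr' ?_
        filter_upwards [self_mem_nhdsWithin] with w hw
        exact ((devExt_coe hdev (g w)).trans (hdgT w hw.1 hw.2)).symm
      exact tendsto_nhds_unique h1 h2
    · rw [hsec y hyz]
      exact (devExt_coe hdev (g y)).trans (hdgT y hy hyz)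
  let A : Set (DevCompletion dev) := sec '' T
  have hA : IsCompact A := s.isCompact_closedInterior.image_of_continuousOn hsecc
  have hAz : ∀ x ∈ A, devExt dev x ≠ z → x ∈ interiorPart dev := by
    rintro x ⟨y, hy, rfl⟩ hx
    rw [hext_sec y hy] at hx
    rw [hsec y hx]
    exact mem_range_self _
  have hsimp : IsSimplexOver dev s A := by
    refine ⟨hA, ?_, ?_, ?_⟩
    · have : CompactSpace A := isCompact_iff_compactSpace.1 hA
      have hc : Continuous (A.domRestrict (devExt dev)) := hext.comp continuous_subtype_val
      refine (hc.isClosedEmbedding ?_).isEmbedding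
      rintro ⟨_, y, hy, rfl⟩ ⟨_, y', hy', rfl⟩ heq
      have h1 : devExt dev (sec y) = devExt dev (sec y') := heq
      rw [hext_sec y hy, hext_sec y' hy'] at h1
      subst h1
      rfl
    · rw [← image_comp]
      have h1 : EqOn (devExt dev ∘ sec) id T := hext_sec
      rw [h1.image_eq, image_id]
    · rintro x ⟨hxA, hx⟩
      exact hAz x hxA fun h => hzint (h ▸ hx)
  -- Every point of the lifted simplex other than the one over `z` lies in `M`. Only the face
  -- opposite vertex `0` contains `z`, so `2`-convexity applies with that face as the exceptional
  -- one.
  have hAint := hconv s A hsimp 0 fun j hj x hx => hAz x hx.1 fun h => hzface j hj (h ▸ hx.2)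
  obtain ⟨m, hm⟩ := hAint (mem_image_of_mem sec hzT)
  rw [hsecz] at hm
  have hGm : Filter.Tendsto G (𝓝[T \ {z}] z) (𝓝 m) := by
    rw [(UniformSpace.Completion.isUniformInducing_coe (DevSpace dev)).isInducing.tendsto_nhds_iff,
      hm]
    exact hξ
  have hdm : dev m = z := by
    rw [← devExt_coe hdev m, ← hext_sec z hzT, hsecz, ← hm]
  obtain ⟨h, hmh, hh, -⟩ := hdev.exists_chart m
  obtain ⟨r, hr, hrh⟩ := exists_devEDist_ball_subset hdev m h hmh hh
  refine ⟨h, hh, ?_, ?_⟩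
  · have h1 : h m ∈ h.target := h.map_source hmh
    rw [hh m, hdm] at h1
    exact h1
  filter_upwards [(hGm.comp htend).eventually (Metric.eball_mem_nhds m hr)] with t ht
  exact hrh _ ((edist_comm (α := DevSpace dev) _ _).trans_lt ht)

end HalfBall

end Drum

/-! ## Existence of the flow -/

namespace Drum

section Develop

variable {n : ℕ} {M : Type*} [TopologicalSpace M] {dev : M → EuclideanSpace ℝ (Fin n)}
  {V : M → EuclideanSpace ℝ (Fin n)}

/-- A linear coordinate of the development in which the field is constant grows linearly along
flow lines. -/
theorem Flow.map_dev {F : Type*} [NormedAddCommGroup F] [NormedSpace ℝ F]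
    (ℓ : EuclideanSpace ℝ (Fin n) →L[ℝ] F) {w : F} (hw : ∀ p, ℓ (V p) = w) {p q : M} {s : ℝ}
    (h : Flow dev V p s q) : ℓ (dev q) = ℓ (dev p) + s • w := by
  obtain ⟨γ, J, hJ, hJc, h0, hs, rfl, rfl, hγ⟩ := h
  have h1 : ∀ t ∈ J, HasDerivAt (fun t => ℓ (dev (γ t)) - t • w) 0 t := by
    intro t ht
    have h2 := ℓ.hasFDerivAt.comp_hasDerivAt t ((hγ t ht).2.hasDerivAt (hJ.mem_nhds ht))
    have h3 := h2.sub ((hasDerivAt_id' t).smul_const w)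
    rw [hw, one_smul, sub_self] at h3
    exact h3
  have h2 := hJ.is_const_of_deriv_eq_zero hJc.isPreconnected
    (fun t ht => (h1 t ht).differentiableAt.differentiableWithinAt)
    (fun t ht => (h1 t ht).deriv) hs h0
  simp only [zero_smul, sub_zero] at h2
  rw [← h2, sub_add_cancel]

theorem isIC_const {c : ℝ → M} {J : Set ℝ} (hc : ContinuousOn c J)
    {y u : EuclideanSpace ℝ (Fin n)} (hcv : ∀ t ∈ J, dev (c t) = y + t • u) :
    IsIC dev (fun _ => u) c J := by
  intro t ht
  refine ⟨hc t ht, ?_⟩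
  have h1 : HasDerivAt (fun t : ℝ => y + t • u) ((1 : ℝ) • u) t :=
    ((hasDerivAt_id' t).smul_const u).const_add y
  rw [one_smul] at h1
  exact h1.hasDerivWithinAt.congr hcv (hcv t ht)

variable [ChartedSpace (EuclideanSpace ℝ (Fin n)) M] [HasGroupoid M (affineGroupoid n)] [T2Space M]

/-- A flow line of a field which is constant off `N` stays a flow line until it meets `N`. -/
theorem mem_flowDomain_of_eq_off (hdev : IsDevelopingMap dev) (hV : ContMDiff (𝓡 n) (𝓡 n) ∞ V)
    {N : Set M} (hN : IsClosed N) {u : EuclideanSpace ℝ (Fin n)} (hVN : ∀ p ∉ N, V p = u) {s : ℝ}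
    (hs : 0 ≤ s) (hNs : ∀ p ∈ N, ∀ t, 0 ≤ t → t ≤ s → (p, t) ∈ flowDomain dev V) {p : M}
    (hp : (p, s) ∈ flowDomain dev (fun _ => u)) : (p, s) ∈ flowDomain dev V := by
  obtain ⟨q, γ, J, hJ, hJc, h0, hsJ, hγp, hγq, hγ⟩ := hp
  change γ 0 = p at hγp
  change s ∈ J at hsJ
  subst hγp
  have hγs : IsIC dev (fun _ => u) γ (Icc 0 s) := hγ.mono (hJc.out h0 hsJ)
  have hIC : ∀ t ∈ Icc 0 s, (∀ r ∈ Icc 0 t, V (γ r) = u) → Flow dev V (γ 0) t (γ t) := by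
    intro t ht h
    refine IsIC.flow_Icc hdev hV ht.1 fun r hr => ?_
    rw [h r hr]
    exact hγs.mono (Icc_subset_Icc_right ht.2) r hr
  by_cases hZ : (Icc 0 s ∩ γ ⁻¹' N).Nonempty
  · have hZc : IsCompact (Icc 0 s ∩ γ ⁻¹' N) :=
      isCompact_Icc.of_isClosed_subset (hγs.continuousOn.preimage_isClosed_of_isClosed
        isClosed_Icc hN) inter_subset_left
    -- The first time at which the line meets `N`: before it the two fields agree along the line,
    -- and afterwards `hNs` supplies the remaining time.
    obtain ⟨t, ⟨ht, htN⟩, htmin⟩ := hZc.exists_isLeast hZ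
    obtain ⟨r, hr⟩ := hNs _ htN (s - t) (by linarith [ht.2]) (by linarith [ht.1])
    have hlt : ∀ r ∈ Ico 0 t, V (γ r) = u := by
      intro r hr
      refine hVN _ fun h => ?_
      exact absurd (htmin ⟨⟨hr.1, hr.2.le.trans ht.2⟩, h⟩) (not_le.2 hr.2)
    rcases ht.1.eq_or_lt with rfl | ht0
    · exact ⟨r, by simpa using hr⟩
    -- The entry point itself lies in `N`; there the value of `V` is obtained by continuity from
    -- earlier times.
    have hVt : V (γ t) = u := by
      have hc : IsClosed {p | V p = u} := isClosed_eq hV.continuous continuous_const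
      have h1 : ContinuousWithinAt γ (Ico 0 t) t :=
        (hγs.continuousOn t ht).mono (Ico_subset_Icc_self.trans (Icc_subset_Icc_right ht.2))
      have h2 := h1.mem_closure (by rw [closure_Ico ht0.ne]; exact ⟨ht0.le, le_rfl⟩)
        (show MapsTo γ (Ico 0 t) {p | V p = u} from hlt)
      rwa [hc.closure_eq] at h2
    have h3 := (hIC t ht fun r hr => (hr.2.eq_or_lt).elim (fun h => h ▸ hVt)
      fun h => hlt r ⟨hr.1, h⟩).trans hdev hV hr
    exact ⟨r, by simpa using h3⟩
  · exact ⟨_, hIC s ⟨hs, le_rfl⟩ fun r hr => hVN _ fun h => hZ ⟨r, hr, h⟩⟩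

end Develop

/-! ### Vertical sweeps and `2`-convexity. -/

section Vertical

variable {M : Type*} [TopologicalSpace M] [ChartedSpace (EuclideanSpace ℝ (Fin 3)) M]
  [HasGroupoid M (affineGroupoid 3)] [T2Space M] {dev : M → EuclideanSpace ℝ (Fin 3)}
  {Ω : Type*} [TopologicalSpace Ω] [CompactSpace Ω]

/-- Sweeping a compact horizontal surface in the vertical direction in a `2`-convex manifold:
only the boundary can run into the ideal set. -/
theorem mem_flowDomain_vert (hdev : IsDevelopingMap dev) (hconv : IsMConvex 2 dev) {σ : ℝ}
    (hσ : σ * σ = 1) {u : EuclideanSpace ℝ (Fin 3)} (hu : u = σ • vert) {S : Ω → M}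
    (hS : Continuous S) {h₀ κ : ℝ} (hSh : ∀ x, dev (S x) 0 = h₀)
    (hSx : ∀ x, (∀ s, 0 ≤ s → s ≤ κ → (S x, s) ∈ flowDomain dev (fun _ => u)) ∨
      ∀ U ∈ 𝓝 x, ∀ᶠ y in 𝓝 (dev (S x)), y 0 = h₀ → ∃ x' ∈ U, dev (S x') = y)
    (x : Ω) {s : ℝ} (hs : 0 ≤ s) (hsκ : s < κ) : (S x, s) ∈ flowDomain dev (fun _ => u) := by
  by_contra hbad
  have hUc : ContMDiff (𝓡 3) (𝓡 3) ∞ (fun _ : M => u) := contMDiff_const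
  have hDo := isOpen_flowDomain hdev hUc
  have hdS : Continuous fun x => dev (S x) := hdev.continuous.comp hS
  -- minimise `s - ε ‖dev (S x)‖ ^ 2` over the pairs for which the flow does not exist
  obtain ⟨R, hR⟩ := isCompact_univ.exists_bound_of_continuousOn
    (f := fun x => ‖dev (S x)‖ ^ 2) (hdS.norm.pow 2).continuousOn
  have hR' : ∀ x, ‖dev (S x)‖ ^ 2 ≤ R := fun x => (le_abs_self _).trans (hR x (mem_univ _))
  have hR0 : 0 ≤ R := (sq_nonneg _).trans (hR' x)
  -- With this `ε` the perturbation is smaller than the gap `κ - s`, which forces the minimiser to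
  -- have `s₀ < κ`.
  obtain ⟨ε, hε, hεR⟩ : ∃ ε > 0, ε * R < κ - s := by
    refine ⟨(κ - s) / (R + 1), div_pos (by linarith) (by linarith), ?_⟩
    rw [div_mul_eq_mul_div, div_lt_iff₀ (by linarith)]
    nlinarith
  let K : Set (Ω × ℝ) := (univ ×ˢ Icc 0 κ) ∩ (fun z => (S z.1, z.2)) ⁻¹' (flowDomain dev fun _ => u)ᶜ
  have hK : IsCompact K := (isCompact_univ.prod isCompact_Icc).inter_right
    (hDo.isClosed_compl.preimage (by fun_prop))
  obtain ⟨⟨x₀, s₀⟩, ⟨⟨-, hs₀⟩, hx₀⟩, hmin⟩ := hK.exists_isMinOn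
    ⟨(x, s), ⟨mem_univ _, hs, hsκ.le⟩, hbad⟩
    (f := fun z => z.2 - ε * ‖dev (S z.1)‖ ^ 2)
    (continuous_snd.sub (continuous_const.mul ((hdS.comp continuous_fst).norm.pow 2))).continuousOn
  change s₀ ∈ Icc 0 κ at hs₀
  change (S x₀, s₀) ∉ flowDomain dev fun _ => u at hx₀
  have hmin' : ∀ x s, 0 ≤ s → s ≤ κ → s - ε * ‖dev (S x)‖ ^ 2 < s₀ - ε * ‖dev (S x₀)‖ ^ 2 →
      (S x, s) ∈ flowDomain dev fun _ => u := by
    intro x s h1 h2 h3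
    by_contra h4
    exact absurd (isMinOn_iff.1 hmin (x, s) ⟨⟨mem_univ _, h1, h2⟩, h4⟩) (not_le.2 h3)
  have hs₀κ : s₀ < κ := by
    have h1 : s₀ - ε * ‖dev (S x₀)‖ ^ 2 ≤ s - ε * ‖dev (S x)‖ ^ 2 :=
      isMinOn_iff.1 hmin (x, s) ⟨⟨mem_univ _, hs, hsκ.le⟩, hbad⟩
    nlinarith [mul_le_mul_of_nonneg_left (hR' x₀) hε.le, mul_nonneg hε.le (sq_nonneg ‖dev (S x)‖)]
  have hs₀0 : 0 < s₀ := by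
    refine hs₀.1.lt_of_ne ?_
    rintro rfl
    exact hx₀ ⟨_, Flow.refl hdev hUc _⟩
  -- At a failing pair the first alternative is excluded, so the surface covers a neighbourhood of
  -- `dev (S x₀)` in its plane.
  have hopen := (hSx x₀).resolve_left fun h => hx₀ (h s₀ hs₀.1 hs₀.2)
  obtain ⟨h, hq, hh, -⟩ := hdev.exists_chart (S x₀)
  set y₀ := dev (S x₀) with hy₀
  have hy₀t : y₀ ∈ h.target := by
    rw [hy₀, ← hh]
    exact h.map_source hq
  obtain ⟨W, hW, hWo, hy₀W⟩ := eventually_nhds_iff.1 ((h.open_target.eventually_mem hy₀t).and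
    (hopen _ (hS.continuousAt.preimage_mem_nhds (h.open_source.mem_nhds hq))))
  have hsymm : ∀ y ∈ W, y 0 = h₀ → ∃ x', h.symm y = S x' ∧ dev (S x') = y := by
    intro y hy hy0
    obtain ⟨x', hx', hxy⟩ := (hW y hy).2 hy0
    refine ⟨x', ?_, hxy⟩
    rw [← hxy, ← hh, h.left_inv hx']
  -- coordinates: the height above the surface and the horizontal projection
  let pr : EuclideanSpace ℝ (Fin 3) →L[ℝ] ℝ := σ • EuclideanSpace.proj 0
  have hpr : ∀ v, pr v = σ * v 0 := fun v => rfl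
  have hu0 : u 0 = σ := by rw [hu, PiLp.smul_apply, vert_zero, smul_eq_mul, mul_one]
  have hpru : pr u = 1 := by rw [hpr, hu0, hσ]
  let P : EuclideanSpace ℝ (Fin 3) →L[ℝ] EuclideanSpace ℝ (Fin 3) :=
    ContinuousLinearMap.id ℝ _ - pr.smulRight u
  have hP : ∀ v, P v = v - pr v • u := fun v => rfl
  have hPu : P u = 0 := by rw [hP, hpru, one_smul, sub_self]
  -- The plane `ℓ = ℓ z₀` is tangent at `z₀` to the paraboloid of points whose height above the
  -- surface minus `ε` times the squared norm of their projection equals the minimum.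
  let ℓ : EuclideanSpace ℝ (Fin 3) →L[ℝ] ℝ := pr - (2 * ε) • (innerSL ℝ y₀).comp P
  have hℓ : ∀ v, ℓ v = pr v - 2 * ε * inner ℝ y₀ (P v) := fun v => rfl
  have hℓu : ℓ u = 1 := by rw [hℓ, hpru, hPu, inner_zero_right, mul_zero, sub_zero]
  let ht : EuclideanSpace ℝ (Fin 3) → ℝ := fun z => pr (z - y₀)
  let pt : EuclideanSpace ℝ (Fin 3) → EuclideanSpace ℝ (Fin 3) := fun z => y₀ + P (z - y₀)
  have hht : Continuous ht := by fun_prop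
  have hpt : Continuous pt := by fun_prop
  have hpt_ht : ∀ z, pt z + ht z • u = z := by
    intro z
    simp only [pt, ht, hP]
    abel
  have hy₀0 : y₀ 0 = h₀ := hSh x₀
  have hpt0 : ∀ z, pt z 0 = h₀ := by
    intro z
    simp only [pt, hP, hpr, PiLp.add_apply, PiLp.sub_apply, PiLp.smul_apply, hu0, hy₀0, smul_eq_mul]
    linear_combination (-(z 0 - h₀)) * hσ
  set z₀ := y₀ + s₀ • u with hz₀
  have hht₀ : ∀ t : ℝ, ht (y₀ + t • u) = t := by
    intro t
    simp only [ht, add_sub_cancel_left, map_smul, hpru, smul_eq_mul, mul_one]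
  have hpt₀ : ∀ t : ℝ, pt (y₀ + t • u) = y₀ := by
    intro t
    simp only [pt, add_sub_cancel_left, map_smul, hPu, smul_zero, add_zero]
  let O := pt ⁻¹' W ∩ ht ⁻¹' Ioo 0 κ
  have hO : O ∈ 𝓝 z₀ := by
    refine ((hWo.preimage hpt).inter (isOpen_Ioo.preimage hht)).mem_nhds ⟨?_, ?_⟩
    · rw [mem_preimage, hpt₀]
      exact hy₀W
    · rw [mem_preimage, hht₀]
      exact ⟨hs₀0, hs₀κ⟩
  -- The section of `dev` obtained by descending to the surface and flowing back up by the height.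
  let g : EuclideanSpace ℝ (Fin 3) → M := fun z => flowMap dev (fun _ => u) (h.symm (pt z), ht z)
  have hdom : ∀ z ∈ O, ℓ z ≤ ℓ z₀ → z ≠ z₀ →
      (h.symm (pt z), ht z) ∈ flowDomain dev fun _ => u := by
    intro z hz hzℓ hzz
    obtain ⟨x', hx', hxz⟩ := hsymm _ hz.1 (hpt0 z)
    rw [hx']
    refine hmin' x' _ hz.2.1.le hz.2.2.le ?_
    rw [hxz]
    -- Together with the expansion of `‖pt z‖²` around `y₀`, this tangent plane inequality puts `z`
    -- below the paraboloid by at least `ε ‖pt z - y₀‖²`. If that vanishes, `z` is on the vertical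
    -- line through `z₀` and strictly lower.
    have h1 : ht z - 2 * ε * inner ℝ y₀ (pt z - y₀) ≤ s₀ := by
      have h2 : ℓ (z - y₀) ≤ ℓ (z₀ - y₀) := by
        rw [map_sub, map_sub]
        linarith
      have h3 : ℓ (z₀ - y₀) = s₀ := by
        rw [hz₀, add_sub_cancel_left, map_smul, hℓu, smul_eq_mul, mul_one]
      rw [h3, hℓ] at h2
      simpa only [pt, add_sub_cancel_left] using h2
    have h2 : ‖pt z‖ ^ 2 = ‖y₀‖ ^ 2 + 2 * inner ℝ y₀ (pt z - y₀) + ‖pt z - y₀‖ ^ 2 := by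
      rw [← norm_add_sq_real, add_sub_cancel]
    rw [h2]
    by_cases hpz : pt z = y₀
    · have h3 : ht z ≠ s₀ := by
        intro h3
        apply hzz
        rw [← hpt_ht z, hpz, h3]
      have h4 : ht z < s₀ := lt_of_le_of_ne (by simpa [hpz] using h1) h3
      simpa [hpz] using h4
    · have h3 : 0 < ‖pt z - y₀‖ ^ 2 := pow_pos (norm_pos_iff.2 (sub_ne_zero.2 hpz)) 2
      nlinarith [mul_pos hε h3]
  have hg : ContinuousOn g {y | y ∈ O ∧ ℓ y ≤ ℓ z₀ ∧ y ≠ z₀} := by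
    rintro z ⟨hz, hzℓ, hzz⟩
    have h1 : ContinuousAt (fun z => (h.symm (pt z), ht z)) z :=
      ((h.continuousAt_symm (hW _ hz.1).1).comp hpt.continuousAt).prodMk hht.continuousAt
    exact (ContinuousAt.comp (f := fun z => (h.symm (pt z), ht z))
      (contMDiffAt_flowMap hdev hUc (hdom z hz hzℓ hzz)).continuousAt h1).continuousWithinAt
  have hdg : ∀ y ∈ O, ℓ y ≤ ℓ z₀ → y ≠ z₀ → dev (g y) = y := by
    intro z hz hzℓ hzz
    have h1 := (flow_flowMap (hdom z hz hzℓ hzz)).map_dev (ContinuousLinearMap.id ℝ _)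
      (w := u) (fun _ => rfl)
    simp only [ContinuousLinearMap.id_apply] at h1
    rw [show dev (g z) = _ from h1, ← hh, h.right_inv (hW _ hz.1).1, hpt_ht]
  obtain ⟨h', hh', hz₀', hev⟩ := exists_chart_of_halfBall hdev hconv hu hℓu hO hg hdg
  obtain ⟨r, hr, hrt⟩ := Metric.isOpen_iff.1 h'.open_target _ hz₀'
  have hnear : ∀ᶠ t in 𝓝[>] (0 : ℝ), z₀ - t • u ∈ Metric.ball z₀ r ∩ O := by
    have h1 : Continuous fun t : ℝ => z₀ - t • u := by fun_prop
    have h2 := (h1.tendsto 0).mono_left (nhdsWithin_le_nhds (s := Ioi 0))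
    rw [zero_smul, sub_zero] at h2
    exact h2.eventually (Filter.inter_mem (Metric.ball_mem_nhds _ hr) hO)
  obtain ⟨t, ⟨ht1, ht2, ht3⟩, ht0⟩ := ((hev.and hnear).and self_mem_nhdsWithin).exists
  change 0 < t at ht0
  have hzt : z₀ - t • u = y₀ + (s₀ - t) • u := by
    rw [hz₀, sub_smul]
    abel
  have hne : z₀ - t • u ≠ z₀ := by
    intro heq
    have := congrArg ℓ heq
    rw [map_sub, map_smul, hℓu, smul_eq_mul] at this
    linarith
  have hle : ℓ (z₀ - t • u) ≤ ℓ z₀ := by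
    rw [map_sub, map_smul, hℓu, smul_eq_mul]
    linarith
  have hflow₁ : Flow dev (fun _ => u) (S x₀) (s₀ - t) (g (z₀ - t • u)) := by
    have h1 := flow_flowMap (hdom _ ht3 hle hne)
    have h2 : pt (z₀ - t • u) = y₀ := by rw [hzt, hpt₀]
    have h3 : ht (z₀ - t • u) = s₀ - t := by rw [hzt, hht₀]
    have h4 : h.symm (pt (z₀ - t • u)) = S x₀ := by rw [h2, hy₀, ← hh, h.left_inv hq]
    simp only [h4, h3] at h1
    simp only [g, h4, h3]
    exact h1
  -- The new chart contains the end of the vertical line just below `z₀`, so the lift continues in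
  -- it up to `z₀` and the flow of `S x₀` reaches the forbidden time `s₀`.
  have hflow₂ : Flow dev (fun _ => u) (g (z₀ - t • u)) t (h'.symm (z₀ - t • u + t • u)) := by
    have hseg : ∀ r ∈ Icc 0 t, z₀ - t • u + r • u ∈ h'.target := by
      intro r hr
      have h1 := (convex_ball z₀ _).add_smul_sub_mem ht2 (Metric.mem_ball_self (by assumption))
        (t := r / t) ⟨div_nonneg hr.1 ht0.le, (div_le_one ht0).2 hr.2⟩
      rw [sub_sub_cancel, smul_smul, div_mul_cancel₀ _ ht0.ne'] at h1
      exact hrt h1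
    have h1 := IsIC.flow_Icc hdev hUc ht0.le (isIC_const (dev := dev)
      (c := fun r => h'.symm (z₀ - t • u + r • u))
      (h'.continuousOn_symm.comp (by fun_prop) hseg)
      (fun r hr => by rw [← hh', h'.right_inv (hseg r hr)]))
    simp only [zero_smul, add_zero] at h1
    have h2 : h'.symm (z₀ - t • u) = g (z₀ - t • u) := by
      conv_lhs => rw [← hdg _ ht3 hle hne]
      rw [← hh', h'.left_inv ht1]
    rwa [h2] at h1
  exact hx₀ ⟨_, by simpa using hflow₁.trans hdev hUc hflow₂⟩

end Vertical

end Drum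

/-! ## Filling the drum -/

namespace Drum

/-! ### Openness of horizontal surfaces in their planes. -/

section Horizontal

variable {H : Type*} [TopologicalSpace H] {I : ModelWithCorners ℝ (EuclideanSpace ℝ (Fin 2)) H}
  {Ω : Type*} [TopologicalSpace Ω] [ChartedSpace H Ω]

/-- A horizontal immersed surface is open in its plane at interior points. -/
theorem eventually_exists_eq_of_isInteriorPoint {G : Ω → EuclideanSpace ℝ (Fin 3)} {x : Ω}
    (hx : I.IsInteriorPoint x) (hG : ContMDiffAt I (𝓡 3) ∞ G x)
    (hinj : Function.Injective (mfderiv I (𝓡 3) G x)) {h₀ : ℝ} (hGh : ∀ x, G x 0 = h₀) {U : Set Ω}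
    (hU : U ∈ 𝓝 x) : ∀ᶠ y in 𝓝 (G x), y 0 = h₀ → ∃ x' ∈ U, G x' = y := by
  let P : EuclideanSpace ℝ (Fin 3) →L[ℝ] (Fin 2 → ℝ) :=
    ContinuousLinearMap.pi fun i => EuclideanSpace.proj i.succ
  have hP : ∀ y z : EuclideanSpace ℝ (Fin 3), y 0 = z 0 → P y = P z → y = z := by
    intro y z h0 h1
    ext i
    refine Fin.cases h0 (fun j => ?_) i
    exact congrFun h1 j
  set w := extChartAt I x x with hw
  have hsymm : (extChartAt I x).symm w = x := extChartAt_to_inv x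
  let F : EuclideanSpace ℝ (Fin 2) → EuclideanSpace ℝ (Fin 3) := G ∘ (extChartAt I x).symm
  have hFw : F w = G x := congrArg G hsymm
  have hrange : range I ∈ 𝓝 w := mem_interior_iff_mem_nhds.1 hx
  have hF : ContDiffAt ℝ ∞ F w := (contMDiffAt_iff.1 hG).2.contDiffAt hrange
  have hFd : HasFDerivAt F (fderiv ℝ F w) w := (hF.differentiableAt (by simp)).hasFDerivAt
  have hFinj : Function.Injective (fderiv ℝ F w) := by
    rw [(hG.mdifferentiableAt (by simp)).mfderiv] at hinj
    have h1 : fderivWithin ℝ (writtenInExtChartAt I (𝓡 3) x G) (range I) w = fderiv ℝ F w := by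
      rw [fderivWithin_of_mem_nhds hrange]
      rfl
    rw [h1] at hinj
    exact hinj
  have hF0 : ∀ v, fderiv ℝ F w v 0 = 0 := by
    intro v
    have h1 := (EuclideanSpace.proj (𝕜 := ℝ) (0 : Fin 3)).hasFDerivAt.comp w hFd
    have h2 : (EuclideanSpace.proj (𝕜 := ℝ) (0 : Fin 3) : EuclideanSpace ℝ (Fin 3) → ℝ) ∘ F =
        fun _ => h₀ := funext fun z => hGh _
    rw [h2] at h1
    exact DFunLike.congr_fun (h1.unique (hasFDerivAt_const h₀ w)) v
  have hPF : HasStrictFDerivAt (P ∘ F) (P.comp (fderiv ℝ F w)) w :=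
    P.hasStrictFDerivAt.comp w (hF.hasStrictFDerivAt (by simp))
  have hsurj : (P.comp (fderiv ℝ F w)).range = ⊤ := by
    refine LinearMap.range_eq_top.2
      ((LinearMap.injective_iff_surjective_of_finrank_eq_finrank (by simp)).1 ?_)
    intro v v' h
    exact hFinj (hP _ _ ((hF0 v).trans (hF0 v').symm) h)
  have hmap := hPF.map_nhds_eq_of_surj hsurj
  have hU' : (P ∘ F) '' ((extChartAt I x).symm ⁻¹' U) ∈ 𝓝 (P (G x)) := by
    rw [← hFw]
    change _ ∈ 𝓝 ((P ∘ F) w)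
    rw [← hmap]
    refine Filter.image_mem_map ((continuousAt_extChartAt_symm x).preimage_mem_nhds ?_)
    rwa [extChartAt_to_inv]
  filter_upwards [P.continuous.continuousAt.preimage_mem_nhds hU'] with y hy hy0
  obtain ⟨v, hv, hvy⟩ := hy
  exact ⟨_, hv, hP _ _ ((hGh _).trans hy0.symm) hvy⟩

end Horizontal

theorem Flow.height {M : Type*} [TopologicalSpace M] {dev V : M → EuclideanSpace ℝ (Fin 3)} {σ : ℝ}
    (hV0 : ∀ p, V p 0 = σ) {p q : M} {s : ℝ} (h : Flow dev V p s q) :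
    height dev q = height dev p + s * σ :=
  h.map_dev (EuclideanSpace.proj (𝕜 := ℝ) (0 : Fin 3)) (w := σ) hV0

section Cylinder

variable {M : Type*} [TopologicalSpace M] [T2Space M] [ChartedSpace (EuclideanSpace ℝ (Fin 3)) M]
  [HasGroupoid M (affineGroupoid 3)] {dev : M → EuclideanSpace ℝ (Fin 3)}
  {V : M → EuclideanSpace ℝ (Fin 3)} {σ : ℝ}

section

variable {E : Type*} [NormedAddCommGroup E] [NormedSpace ℝ E] {H : Type*} [TopologicalSpace H]
  {I : ModelWithCorners ℝ E H} {Ω : Type*} [TopologicalSpace Ω] [ChartedSpace H Ω] {S : Ω → M}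

theorem contMDiffAt_flowMap_comp (hdev : IsDevelopingMap dev) (hV : ContMDiff (𝓡 3) (𝓡 3) ∞ V)
    (hS : ContMDiff I (𝓡 3) ∞ S) {s : ℝ} {x : Ω} (h : (S x, s) ∈ flowDomain dev V) :
    ContMDiffAt I (𝓡 3) ∞ (fun x => flowMap dev V (S x, s)) x :=
  ContMDiffAt.comp x (f := fun x => (S x, s)) (contMDiffAt_flowMap hdev hV h)
    (hS.contMDiffAt.prodMk contMDiffAt_const)

theorem mfderiv_flowMap_comp_injective (hdev : IsDevelopingMap dev)
    (hV : ContMDiff (𝓡 3) (𝓡 3) ∞ V) (hS : ContMDiff I (𝓡 3) ∞ S) {s : ℝ} {x : Ω}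
    (hinj : Function.Injective (mfderiv I (𝓡 3) S x)) (h : (S x, s) ∈ flowDomain dev V) :
    Function.Injective (mfderiv I (𝓡 3) (fun x => flowMap dev V (S x, s)) x) := by
  have h1 := contMDiffAt_flowMap_comp hdev hV (contMDiff_id (I := 𝓡 3) (M := M)) h
  have h2 := contMDiffAt_flowMap_comp hdev hV (contMDiff_id (I := 𝓡 3) (M := M))
    (x := flowMap dev V (S x, s)) (s := -s) ⟨_, (flow_flowMap h).symm⟩
  have h3 : Function.Injective (mfderiv (𝓡 3) (𝓡 3) (fun p => flowMap dev V (p, s)) (S x)) := by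
    refine mfderiv_injective_of_eventually_leftInverse (h1.mdifferentiableAt (by simp))
      (h2.mdifferentiableAt (by simp)) ?_
    have h4 : Continuous fun p : M => (p, s) := by fun_prop
    filter_upwards [h4.continuousAt.preimage_mem_nhds
      ((isOpen_flowDomain hdev hV).mem_nhds h)] with p hp
    exact (flow_flowMap hp).symm.flowMap_eq hdev hV
  have h4 := mfderiv_comp x (I' := 𝓡 3) (g := fun p => flowMap dev V (p, s)) (f := S)
    (h1.mdifferentiableAt (by simp)) (hS.mdifferentiableAt (by simp))
  change Function.Injective (mfderiv I (𝓡 3) ((fun p => flowMap dev V (p, s)) ∘ S) x)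
  rw [h4]
  exact h3.comp hinj

end

variable {H : Type*} [TopologicalSpace H] {I : ModelWithCorners ℝ (EuclideanSpace ℝ (Fin 2)) H}
  {Ω : Type*} [TopologicalSpace Ω] [ChartedSpace H Ω] {S : Ω → M}

/-- In a `2`-convex manifold the flow of a field which is vertical off a compact set exists on a
compact horizontal surface as long as it exists on the boundary of the surface. -/
theorem mem_flowDomain_of_boundary [CompactSpace Ω] (hdev : IsDevelopingMap dev)
    (hconv : IsMConvex 2 dev) (hσ : σ * σ = 1) (hV : ContMDiff (𝓡 3) (𝓡 3) ∞ V)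
    (hV0 : ∀ p, V p 0 = σ) {N : Set M} (hN : IsCompact N) (hVN : ∀ p ∉ N, V p = σ • vert)
    (hS : IsSmoothEmb I (𝓡 3) S) {h₀ L : ℝ} (hSh : ∀ x, S x ∈ level dev h₀)
    (hbd : ∀ x ∈ I.boundary Ω, ∀ s, 0 ≤ s → s ≤ L → ∃ q ∈ N, Flow dev V (S x) s q) (x : Ω) {s : ℝ}
    (hs : 0 ≤ s) (hsL : s ≤ L) : (S x, s) ∈ flowDomain dev V := by
  obtain ⟨κ₁, hκ₁, h₁⟩ := exists_uniform_flow_time hdev hV hN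
  obtain ⟨κ₂, hκ₂, h₂⟩ := exists_uniform_flow_time hdev
    (contMDiff_const (c := σ • vert) (I := 𝓡 3) (I' := 𝓡 3) (M := M)) hN
  set κ := min κ₁ κ₂
  have hκ : 0 < κ := lt_min hκ₁ hκ₂
  have key : ∀ (k : ℕ) (x : Ω) (s : ℝ), 0 ≤ s → s ≤ L → s ≤ k * (κ / 2) →
      (S x, s) ∈ flowDomain dev V := by
    intro k
    induction k with
    | zero =>
      intro x s hs _ hsk
      rw [Nat.cast_zero, zero_mul] at hsk
      rw [le_antisymm hsk hs]
      exact ⟨_, Flow.refl hdev hV _⟩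
    | succ k ih =>
      intro x s hs hsL hsk
      rcases le_or_gt s (k * (κ / 2)) with hle | hlt
      · exact ih x s hs hsL hle
      set r := (k : ℝ) * (κ / 2)
      have hr : 0 ≤ r := by positivity
      have hrL : r ≤ L := hlt.le.trans hsL
      have hdom : ∀ x, (S x, r) ∈ flowDomain dev V := fun x => ih x r hr hrL le_rfl
      have hsr : s - r ≤ κ / 2 := by
        rw [Nat.cast_succ, add_mul, one_mul] at hsk
        exact sub_le_iff_le_add'.2 hsk
      let S' : Ω → M := fun x => flowMap dev V (S x, r)
      have hS' : ∀ x, Flow dev V (S x) r (S' x) := fun x => flow_flowMap (hdom x)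
      have hS'c : ∀ x, ContMDiffAt I (𝓡 3) ∞ S' x := fun x =>
        contMDiffAt_flowMap_comp hdev hV hS.contMDiff (hdom x)
      have hS'h : ∀ x, dev (S' x) 0 = h₀ + r * σ := by
        intro x
        have h3 := (hS' x).height hV0
        rwa [show height dev (S x) = h₀ from hSh x] at h3
      have hvert := mem_flowDomain_vert hdev hconv hσ rfl (S := S')
        (continuous_iff_continuousAt.2 fun x => (hS'c x).continuousAt) (κ := κ) hS'h ?_ x
        (s := s - r) (by linarith) (by linarith)
      · obtain ⟨q, hq⟩ := mem_flowDomain_of_eq_off hdev hV hN.isClosed hVN (by linarith)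
          (fun p hp t h3 h4 => h₁ p hp t h3 (h4.trans (hsr.trans
            ((half_le_self hκ.le).trans (min_le_left _ _))))) hvert
        exact ⟨q, by simpa using (hS' x).trans hdev hV hq⟩
      · intro x
        rcases I.isInteriorPoint_or_isBoundaryPoint x with hx | hx
        · right
          intro U hU
          refine eventually_exists_eq_of_isInteriorPoint hx
            (hdev.contMDiff.contMDiffAt.comp x (hS'c x)) ?_ hS'h hU
          have h3 := mfderiv_comp x (I' := 𝓡 3) (g := dev) (f := S')
            (hdev.contMDiff.mdifferentiableAt (by simp)) ((hS'c x).mdifferentiableAt (by simp))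
          change Function.Injective (mfderiv I (𝓡 3) (dev ∘ S') x)
          rw [h3]
          exact (hdev.mfderiv_injective _).comp
            (mfderiv_flowMap_comp_injective hdev hV hS.contMDiff (hS.injective_mfderiv x) (hdom x))
        · left
          intro t ht htκ
          obtain ⟨q, hqN, hq⟩ := hbd x hx r hr hrL
          rw [(hS' x).unique hdev hV hq]
          exact h₂ q hqN t ht (htκ.trans (min_le_right _ _))
  obtain ⟨k, hk⟩ := exists_nat_ge (s / (κ / 2))
  exact key k x s hs hsL ((div_le_iff₀ (by positivity)).1 hk)

/-- The cylinder swept out by a compact horizontal surface under a flow of constant vertical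
speed. -/
theorem isSolidCylinderEmb_flowMap [CompactSpace Ω] (hdev : IsDevelopingMap dev) (hσ : σ * σ = 1)
    (hV : ContMDiff (𝓡 3) (𝓡 3) ∞ V) (hV0 : ∀ p, V p 0 = σ) (hS : IsSmoothEmb I (𝓡 3) S)
    {a b e : ℝ} (hSe : ∀ x, S x ∈ level dev e)
    (hdom : ∀ x, ∀ t ∈ Icc a b, (S x, σ * (t - e)) ∈ flowDomain dev V) :
    IsSolidCylinderEmb I dev a b (fun z : Ω × ℝ => flowMap dev V (S z.1, σ * (z.2 - e))) := by
  set Φ : Ω × ℝ → M := fun z => flowMap dev V (S z.1, σ * (z.2 - e))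
  let α : Ω × ℝ → M × ℝ := fun z => (S z.1, σ * (z.2 - e))
  have hα : ContMDiff (I.prod 𝓘(ℝ, ℝ)) ((𝓡 3).prod 𝓘(ℝ, ℝ)) ∞ α := by
    refine (hS.contMDiff.comp contMDiff_fst).prodMk ?_
    have h1 : ContMDiff 𝓘(ℝ, ℝ) 𝓘(ℝ, ℝ) ∞ fun t : ℝ => σ * (t - e) :=
      (contDiff_const.mul (contDiff_id.sub contDiff_const)).contMDiff
    exact h1.comp contMDiff_snd
  have hD := isOpen_flowDomain hdev hV
  have hΦ : ∀ z, α z ∈ flowDomain dev V → ContMDiffAt (I.prod 𝓘(ℝ, ℝ)) (𝓡 3) ∞ Φ z := fun z hz =>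
    ContMDiffAt.comp z (contMDiffAt_flowMap hdev hV hz) hα.contMDiffAt
  have hflow : ∀ z, α z ∈ flowDomain dev V → Flow dev V (S z.1) (σ * (z.2 - e)) (Φ z) := fun z hz =>
    flow_flowMap hz
  have hheight : ∀ z, α z ∈ flowDomain dev V → height dev (Φ z) = z.2 := by
    intro z hz
    rw [(hflow z hz).height hV0, show height dev (S z.1) = e from hSe z.1]
    linear_combination (z.2 - e) * hσ
  refine ⟨⟨(Prod.snd '' (α ⁻¹' (flowDomain dev V)ᶜ))ᶜ, ?_, ?_, ?_⟩, ?_, ?_, ?_⟩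
  · exact (isClosedMap_snd_of_compactSpace _ (hD.isClosed_compl.preimage hα.continuous)).isOpen_compl
  · rintro t ht ⟨⟨x, t⟩, hx, rfl⟩
    exact hx (hdom x t ht)
  · rintro ⟨x, t⟩ ⟨-, ht⟩
    refine (hΦ _ ?_).contMDiffWithinAt
    by_contra h
    exact ht ⟨(x, t), h, rfl⟩
  · intro x t ht
    have hz : α (x, t) ∈ flowDomain dev V := hdom x t ht
    let β : M → M × ℝ := fun q =>
      (flowMap dev V (q, -(σ * (height dev q - e))), height dev q)
    have hheight_smooth : ContMDiff (𝓡 3) 𝓘(ℝ, ℝ) ∞ (height dev) :=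
      (EuclideanSpace.proj (𝕜 := ℝ) (0 : Fin 3)).contMDiff.comp hdev.contMDiff
    have hβ : ContMDiffAt (𝓡 3) ((𝓡 3).prod 𝓘(ℝ, ℝ)) ∞ β (Φ (x, t)) := by
      refine ContMDiffAt.prodMk ?_ hheight_smooth.contMDiffAt
      have h1 : ContMDiff 𝓘(ℝ, ℝ) 𝓘(ℝ, ℝ) ∞ fun t : ℝ => -(σ * (t - e)) :=
        (contDiff_const.mul (contDiff_id.sub contDiff_const)).neg.contMDiff
      refine ContMDiffAt.comp (Φ (x, t)) (f := fun q => (q, -(σ * (height dev q - e))))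
        (contMDiffAt_flowMap hdev hV ?_)
        (contMDiffAt_id.prodMk (h1.comp hheight_smooth).contMDiffAt)
      rw [hheight _ hz]
      exact ⟨_, (hflow _ hz).symm⟩
    have hβΦ : β ∘ Φ =ᶠ[𝓝 (x, t)] Prod.map S id := by
      filter_upwards [hα.continuous.continuousAt.preimage_mem_nhds (hD.mem_nhds hz)] with z hz'
      change (flowMap dev V (Φ z, -(σ * (height dev (Φ z) - e))), height dev (Φ z)) = (S z.1, z.2)
      rw [hheight z hz', (hflow z hz').symm.flowMap_eq hdev hV]
    have h1 := mfderiv_comp (x, t) (hβ.mdifferentiableAt (by simp))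
      ((hΦ _ hz).mdifferentiableAt (by simp))
    rw [hβΦ.mfderiv_eq, mfderiv_prodMap (hS.contMDiff.mdifferentiableAt (by simp))
      mdifferentiableAt_id, mfderiv_id] at h1
    have h2 : Function.Injective ((mfderiv I (𝓡 3) S x).prodMap
        (ContinuousLinearMap.id ℝ (TangentSpace 𝓘(ℝ, ℝ) t))) :=
      (hS.injective_mfderiv x).prodMap Function.injective_id
    refine Function.Injective.of_comp (f := mfderiv (𝓡 3) ((𝓡 3).prod 𝓘(ℝ, ℝ)) β (Φ (x, t))) ?_
    intro v v' hv
    refine h2 ?_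
    change (mfderiv I (𝓡 3) S x).prodMap _ v = (mfderiv I (𝓡 3) S x).prodMap _ v'
    exact (DFunLike.congr_fun h1 v).trans (hv.trans (DFunLike.congr_fun h1 v').symm)
  · have : CompactSpace (univ ×ˢ Icc a b : Set (Ω × ℝ)) :=
      isCompact_iff_compactSpace.1 (isCompact_univ.prod isCompact_Icc)
    have hc : Continuous ((univ ×ˢ Icc a b : Set (Ω × ℝ)).domRestrict Φ) := by
      refine ContinuousOn.domRestrict ?_
      rintro ⟨x, t⟩ ⟨-, ht⟩
      exact (hΦ _ (hdom x t ht)).continuousAt.continuousWithinAt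
    refine (hc.isClosedEmbedding ?_).isEmbedding
    rintro ⟨⟨x, t⟩, hx, ht⟩ ⟨⟨x', t'⟩, hx', ht'⟩ hΦeq
    change Φ (x, t) = Φ (x', t') at hΦeq
    have h1 : t = t' := by
      have h2 := congrArg (height dev) hΦeq
      rwa [hheight _ (hdom x t ht), hheight _ (hdom x' t' ht')] at h2
    subst h1
    have h3 := hflow (x', t) (hdom x' t ht')
    rw [← hΦeq] at h3
    have h4 := hS.isEmbedding.injective ((hflow (x, t) (hdom x t ht)).unique_left hdev hV h3)
    subst h4
    rfl
  · exact fun x t ht => hheight _ (hdom x t ht)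

end Cylinder

end Drum

theorem mainTheorem8
    {M : Type*} [TopologicalSpace M] [T2Space M] [SecondCountableTopology M]
    [ChartedSpace (EuclideanSpace ℝ (Fin 3)) M] [HasGroupoid M (Drum.affineGroupoid 3)]
    [SimplyConnectedSpace M]
    (dev : M → EuclideanSpace ℝ (Fin 3)) (hdev : Drum.IsDevelopingMap dev)
    (hconv : Drum.IsMConvex 2 dev)
    -- the compact surface `Ω` and its boundary `δΩ`, as the image of a smooth embedding `ι`
    {Ω : Type*} [TopologicalSpace Ω] [T2Space Ω] [CompactSpace Ω]
    [ChartedSpace (EuclideanHalfSpace 2) Ω] [IsManifold (𝓡∂ 2) ∞ Ω]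
    {C : Type*} [TopologicalSpace C] [ChartedSpace (EuclideanSpace ℝ (Fin 1)) C]
    [IsManifold (𝓡 1) ∞ C]
    (ι : C → Ω) (hι : Drum.IsSmoothEmb (𝓡 1) (𝓡∂ 2) ι)
    (hιrange : range ι = (𝓡∂ 2).boundary Ω)
    {a b : ℝ} (hab : a < b)
    -- the level-preserving family of curves
    (f : C × ℝ → M) (hf : Drum.IsSmoothOnBand (𝓡 1) (𝓡 3) a b f)
    (hf_emb : ∀ t ∈ Icc a b, Drum.IsSmoothEmb (𝓡 1) (𝓡 3) (fun c => f (c, t)) ∧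
      ∀ c, f (c, t) ∈ Drum.level dev t)
    (hf_trans : Drum.IsTransversalToLevels (𝓡 1) dev a b f)
    -- the cap at one end `e` of `[a, b]`
    (e : ℝ) (he : e = a ∨ e = b)
    (f' : Ω → M) (hf' : Drum.IsSmoothEmb (𝓡∂ 2) (𝓡 3) f')
    (hf'_level : ∀ x, f' x ∈ Drum.level dev e) (hf'_ext : ∀ c, f' (ι c) = f (c, e)) :
    ∃ Φ : Ω × ℝ → M, Drum.IsSolidCylinderEmb (𝓡∂ 2) dev a b Φ ∧
      (∀ c, ∀ t ∈ Icc a b, Φ (ι c, t) = f (c, t)) ∧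
      (∀ x, Φ (x, e) = f' x) := by
  have hclosed : IsClosed (range ι) := by
    rw [hιrange]
    exact ModelWithCorners.isClosed_boundary (I := 𝓡∂ 2) (M := Ω) (n := ∞) (by simp)
  have : CompactSpace C :=
    (Topology.IsClosedEmbedding.mk hι.isEmbedding hclosed).compactSpace
  obtain ⟨V, hV, hV0, hVf, hfc, N, hN, hfN, hVN⟩ :=
    Drum.exists_extension_field hdev hab hf hf_emb
  obtain ⟨σ, hσ, hσe, hσI⟩ : ∃ σ : ℝ, σ * σ = 1 ∧
      (∀ t ∈ Icc a b, σ * (t - e) ∈ Icc 0 (b - a)) ∧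
      ∀ s ∈ Icc 0 (b - a), e + σ * s ∈ Icc a b := by
    rcases he with rfl | rfl
    · refine ⟨1, by norm_num, ?_, ?_⟩ <;> rintro t ⟨h1, h2⟩ <;> constructor <;> linarith
    · refine ⟨-1, by norm_num, ?_, ?_⟩ <;> rintro t ⟨h1, h2⟩ <;> constructor <;> linarith
  let W : M → EuclideanSpace ℝ (Fin 3) := fun p => σ • V p
  have hW : ContMDiff (𝓡 3) (𝓡 3) ∞ W := (contDiff_const_smul σ).contMDiff.comp hV
  have hW0 : ∀ p, W p 0 = σ := fun p => by
    rw [PiLp.smul_apply, hV0, smul_eq_mul, mul_one]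
  have hflow : ∀ c, ∀ s, 0 ≤ s → s ≤ b - a → Drum.Flow dev W (f' (ι c)) s (f (c, e + σ * s)) := by
    intro c s hs hsL
    have hsub : ∀ r ∈ Icc 0 s, e + σ * r ∈ Icc a b := fun r hr => hσI r ⟨hr.1, hr.2.trans hsL⟩
    have h1 := Drum.IsIC.flow_Icc hdev hW hs (γ := fun r => f (c, e + σ * r)) (by
      intro r hr
      refine ⟨((hfc c).comp (f := fun r => e + σ * r) (by fun_prop) hsub) r hr, ?_⟩
      have h2 : HasDerivAt (fun r => e + σ * r) (σ * 1) r :=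
        ((hasDerivAt_id' r).const_mul σ).const_add e
      rw [mul_one] at h2
      exact ((hVf c _ (hsub r hr)).scomp r h2).hasDerivWithinAt)
    simp only [mul_zero, add_zero] at h1
    rwa [hf'_ext]
  have hdom : ∀ x, ∀ s, 0 ≤ s → s ≤ b - a → (f' x, s) ∈ Drum.flowDomain dev W := by
    intro x s hs hsL
    refine Drum.mem_flowDomain_of_boundary hdev hconv hσ hW hW0 hN
      (fun p hp => congrArg (σ • ·) (hVN p hp)) hf' hf'_level ?_ x hs hsL
    rw [← hιrange]
    rintro _ ⟨c, rfl⟩ s hs hsL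
    exact ⟨_, hfN c _ (hσI s ⟨hs, hsL⟩), hflow c s hs hsL⟩
  refine ⟨_, Drum.isSolidCylinderEmb_flowMap hdev hσ hW hW0 hf' hf'_level
    (fun x t ht => hdom x _ (hσe t ht).1 (hσe t ht).2), fun c t ht => ?_, fun x => ?_⟩
  · have h1 := (hflow c _ (hσe t ht).1 (hσe t ht).2).flowMap_eq hdev hW
    refine h1.trans ?_
    rw [← mul_assoc, hσ, one_mul, add_sub_cancel]
  · simp only [sub_self, mul_zero]
    exact (Drum.Flow.refl hdev hW _).flowMap_eq hdev hW
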